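/- Let $\mathcal S_1 \xrightarrow{\phi_1} \mathcal S_2 \xrightarrow{\phi_2} \mathcal S_3 \xrightarrow{\phi_3} \cdots$ be a sequence of (abstract) operator systems, i.e. matrix ordered $*$-vector spaces with an Archimedean matrix order unit, and let the $\phi_k$ be arbitrary unital completely positive maps (they need not be injective or order embeddings). Let $\varinjlim \mathcal S_k$, with canonical maps $\phi_{k,\infty}$, be its inductive limit in the category of operator systems and unital completely positive maps, that is, the Archimedeanisation of the algebraic inductive limit with the cones $\bigcup_k \ddot\phi_{k,\infty}^{(n)}(M_n(\mathcal S_k)^+)$, where $\ddot\phi_{k,\infty}$ denotes the canonical map of $\mathcal S_k$ into the algebraic limit. For operator systems $\mathcal S,\mathcal T$ let $\mathcal S\otimes_{\max}\mathcal T$ be the Archimedeanisation of the algebraic tensor product $\mathcal S\odot\mathcal T$ with order unit $e_{\mathcal S}\otimes e_{\mathcal T}$ and the cones $$P_n^{\max}=\{\alpha(C\otimes D)\alpha^* : C\in M_k(\mathcal S)^+,\ D\in M_m(\mathcal T)^+,\ \alpha\in M_{n,km}(\mathbb C),\ k,m\in\mathbb N\}.$$ Let $\mathcal T$ be any operator system,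 and let $\varinjlim(\mathcal S_k\otimes_{\max}\mathcal T)$, with canonical maps $\psi_{k,\infty}$, be the inductive limit of the system with connecting maps $\phi_k\otimes\mathrm{id}_{\mathcal T}$. Then there is a unital complete order isomorphism $$\beta:\varinjlim(\mathcal S_k\otimes_{\max}\mathcal T)\;\longrightarrow\;(\varinjlim \mathcal S_k)\otimes_{\max}\mathcal T$$ (a linear bijection that is unital and completely positive together with its inverse) such that $\beta(\psi_{k,\infty}(s\otimes t))=\phi_{k,\infty}(s)\otimes t$ for all $k$, $s\in\mathcal S_k$ and $t\in\mathcal T$. -/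

import Mathlib

noncomputable section

open scoped TensorProduct ComplexOrder

/-- The compression `α X α*` of an `S`-valued matrix `X` by a scalar matrix `α`. -/
def compr {S : Type*} [AddCommGroup S] [Module ℂ S] {m n : Type*} [Fintype n]
    (α : Matrix m n ℂ) (X : Matrix n n S) : Matrix m m S :=
  Matrix.of fun i j => ∑ a, ∑ b, (α i a * star (α j b)) • X a b

/-- A matrix ordered *-vector space with matrix order unit: cones `pos n` in the hermitian
part of `M_n(S)` with `pos n ∩ -pos n = {0}`, compatible under compression by scalar matrices,
and a positive element `unit` such that `diag(unit, …, unit)` is an order unit of `M_n(S)`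
for every `n`. -/
class MOUSpace (S : Type*) [AddCommGroup S] [Module ℂ S] [StarAddMonoid S]
    [StarModule ℂ S] where
  pos : ∀ n : ℕ, Set (Matrix (Fin n) (Fin n) S)
  unit : S
  isHermitian_of_pos : ∀ {n : ℕ} {X : Matrix (Fin n) (Fin n) S}, X ∈ pos n → X.IsHermitian
  add_pos : ∀ {n : ℕ} {X Y : Matrix (Fin n) (Fin n) S}, X ∈ pos n → Y ∈ pos n → X + Y ∈ pos n
  smul_pos : ∀ {n : ℕ} {r : ℝ} {X : Matrix (Fin n) (Fin n) S}, 0 ≤ r → X ∈ pos n →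
    (r : ℂ) • X ∈ pos n
  proper : ∀ {n : ℕ} {X : Matrix (Fin n) (Fin n) S}, X ∈ pos n → -X ∈ pos n → X = 0
  compr_pos : ∀ {m n : ℕ} (α : Matrix (Fin m) (Fin n) ℂ) {X : Matrix (Fin n) (Fin n) S},
    X ∈ pos n → compr α X ∈ pos m
  unit_pos : (Matrix.of fun _ _ : Fin 1 => unit) ∈ pos 1
  order_unit : ∀ {n : ℕ} {X : Matrix (Fin n) (Fin n) S}, X.IsHermitian →
    ∃ r : ℝ, 0 < r ∧ (r : ℂ) • (Matrix.diagonal fun _ => unit) - X ∈ pos n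

/-- An operator system: the matrix order unit is Archimedean at every matrix level. -/
class OperatorSystem (S : Type*) [AddCommGroup S] [Module ℂ S] [StarAddMonoid S]
    [StarModule ℂ S] extends MOUSpace S where
  archimedean : ∀ {n : ℕ} {X : Matrix (Fin n) (Fin n) S}, X.IsHermitian →
    (∀ r : ℝ, 0 < r → (r : ℂ) • (Matrix.diagonal fun _ => unit) + X ∈ pos n) → X ∈ pos n

namespace MOUSpace

section Basic

variable {S : Type*} [AddCommGroup S] [Module ℂ S] [StarAddMonoid S] [StarModule ℂ S]
variable {T : Type*} [AddCommGroup T] [Module ℂ T] [StarAddMonoid T] [StarModule ℂ T]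

/-- The element `e^(n) = diag(e, …, e)` of `M_n(S)`, where `e` is the matrix order unit. -/
def matUnit (S : Type*) [AddCommGroup S] [Module ℂ S] [StarAddMonoid S] [StarModule ℂ S]
    [MOUSpace S] (n : ℕ) : Matrix (Fin n) (Fin n) S :=
  Matrix.diagonal fun _ => unit

/-- Positivity of an element of `S`, through the identification `M_1(S) = S`. -/
def IsPos [MOUSpace S] (v : S) : Prop := (Matrix.of fun _ _ : Fin 1 => v) ∈ pos 1

/-- Unital completely positive linear maps. -/
structure IsUCP [MOUSpace S] [MOUSpace T] (f : S →ₗ[ℂ] T) : Prop where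
  map_unit : f unit = unit
  map_pos : ∀ {n : ℕ} {X : Matrix (Fin n) (Fin n) S}, X ∈ pos n → X.map f ∈ pos n

/-- Unital complete order isomorphisms: linear bijections that are unital and completely
positive together with their inverse. -/
structure IsUnitalCompleteOrderIso [MOUSpace S] [MOUSpace T] (f : S ≃ₗ[ℂ] T) : Prop where
  ucp : IsUCP (f : S →ₗ[ℂ] T)
  symm_ucp : IsUCP (f.symm : T →ₗ[ℂ] S)

/-- States: unital positive functionals. -/
structure IsState [MOUSpace S] (f : S →ₗ[ℂ] ℂ) : Prop where
  map_unit : f unit = 1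
  map_pos : ∀ {v : S}, IsPos v → 0 ≤ f v

/-- The null space: the common kernel of all states. -/
def nullSpace (S : Type*) [AddCommGroup S] [Module ℂ S] [StarAddMonoid S] [StarModule ℂ S]
    [MOUSpace S] : Submodule ℂ S where
  carrier := {v | ∀ f : S →ₗ[ℂ] ℂ, IsState f → f v = 0}
  add_mem' := fun ha hb f hf => by rw [map_add, ha f hf, hb f hf, add_zero]
  zero_mem' := fun f _ => map_zero f
  smul_mem' := fun c x hx f hf => by rw [map_smul, hx f hf, smul_zero]

end Basic

section Compr

variable {S : Type*} [AddCommGroup S] [Module ℂ S] {T : Type*} [AddCommGroup T] [Module ℂ T]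

theorem compr_map {m n : Type*} [Fintype n] (f : S →ₗ[ℂ] T) (α : Matrix m n ℂ)
    (X : Matrix n n S) : (compr α X).map f = compr α (X.map f) := by
  ext i j
  simp [compr, map_sum]

theorem compr_add {m n : Type*} [Fintype n] (α : Matrix m n ℂ) (X Y : Matrix n n S) :
    compr α (X + Y) = compr α X + compr α Y := by
  ext i j
  simp [compr, Finset.sum_add_distrib]

theorem compr_smul {m n : Type*} [Fintype n] (α : Matrix m n ℂ) (c : ℂ) (X : Matrix n n S) :
    compr α (c • X) = c • compr α X := by
  ext i j
  simp [compr, Finset.smul_sum, smul_comm c]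

theorem compr_neg {m n : Type*} [Fintype n] (α : Matrix m n ℂ) (X : Matrix n n S) :
    compr α (-X) = -compr α X := by
  ext i j
  simp [compr]

theorem compr_compr {l m n : Type*} [Fintype m] [Fintype n] (β : Matrix l m ℂ)
    (α : Matrix m n ℂ) (X : Matrix n n S) : compr β (compr α X) = compr (β * α) X := by
  ext i j
  simp only [compr, Matrix.of_apply, Finset.smul_sum, smul_smul, Matrix.mul_apply, star_sum,
    Finset.sum_mul, Finset.mul_sum, Finset.sum_smul, star_mul']
  have h : ∀ p q a b, β i p * star (β j q) * (α p a * star (α q b)) =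
      β i p * α p a * (star (β j q) * star (α q b)) := by intros; ring
  simp only [h]
  calc _ = ∑ p, ∑ a, ∑ q, ∑ b,
        (β i p * α p a * (star (β j q) * star (α q b))) • X a b :=
        Finset.sum_congr rfl fun _ _ => Finset.sum_comm
    _ = ∑ a, ∑ p, ∑ q, ∑ b,
        (β i p * α p a * (star (β j q) * star (α q b))) • X a b := Finset.sum_comm
    _ = ∑ a, ∑ p, ∑ b, ∑ q,
        (β i p * α p a * (star (β j q) * star (α q b))) • X a b :=
        Finset.sum_congr rfl fun _ _ => Finset.sum_congr rfl fun _ _ => Finset.sum_comm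
    _ = ∑ a, ∑ b, ∑ p, ∑ q,
        (β i p * α p a * (star (β j q) * star (α q b))) • X a b :=
        Finset.sum_congr rfl fun _ _ => Finset.sum_comm
    _ = _ := Finset.sum_congr rfl fun _ _ => Finset.sum_congr rfl fun _ _ => Finset.sum_comm

theorem compr_one {n : Type*} [Fintype n] [DecidableEq n] (X : Matrix n n S) :
    compr (1 : Matrix n n ℂ) X = X := by
  ext i j
  simp [compr, Matrix.one_apply]

end Compr

section Basic

variable {S : Type*} [AddCommGroup S] [Module ℂ S] [StarAddMonoid S]
variable {T : Type*} [AddCommGroup T] [Module ℂ T] [StarAddMonoid T]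

theorem map_isHermitian {n : Type*} (f : S →ₗ[ℂ] T) (hf : ∀ x, f (star x) = star (f x))
    {X : Matrix n n S} (hX : X.IsHermitian) : (X.map f).IsHermitian := by
  ext i j
  simp [← hf, hX.apply]

variable [StarModule ℂ S] [StarModule ℂ T]

theorem compr_isHermitian {m n : Type*} [Fintype n] (α : Matrix m n ℂ) {X : Matrix n n S}
    (hX : X.IsHermitian) : (compr α X).IsHermitian := by
  ext i j
  have h : ∀ a b, star (X a b) = X b a := fun a b => hX.apply b a
  simp only [compr, Matrix.conjTranspose_apply, Matrix.of_apply, star_sum, star_smul, h,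
    star_mul', star_star]
  rw [Finset.sum_comm]
  exact Finset.sum_congr rfl fun a _ => Finset.sum_congr rfl fun b _ => by rw [mul_comm]

theorem smul_isHermitian {n : Type*} (r : ℝ) {X : Matrix n n S} (hX : X.IsHermitian) :
    ((r : ℂ) • X).IsHermitian := by
  ext i j
  simp [hX.apply]

variable [MOUSpace S] [MOUSpace T]

theorem zero_pos (n : ℕ) : (0 : Matrix (Fin n) (Fin n) S) ∈ pos n := by
  have h := compr_pos (0 : Matrix (Fin n) (Fin 1) ℂ) (unit_pos (S := S))
  convert h using 1
  ext i j
  simp [compr]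

theorem sum_pos {ι : Type*} (s : Finset ι) {n : ℕ} (f : ι → Matrix (Fin n) (Fin n) S)
    (h : ∀ i ∈ s, f i ∈ pos n) : ∑ i ∈ s, f i ∈ pos n := by
  classical
  induction s using Finset.induction_on with
  | empty => simpa using zero_pos n
  | insert a s ha ih =>
    rw [Finset.sum_insert ha]
    exact add_pos (h _ (Finset.mem_insert_self _ _))
      (ih fun i hi => h i (Finset.mem_insert_of_mem hi))

theorem matUnit_pos (n : ℕ) : matUnit S n ∈ pos n := by
  have h : matUnit S n = ∑ i : Fin n, compr (Matrix.single i (0 : Fin 1) (1 : ℂ))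
      (Matrix.of fun _ _ : Fin 1 => (unit : S)) := by
    ext a b
    simp only [matUnit, Matrix.sum_apply, compr, Matrix.of_apply, Fin.sum_univ_one,
      Matrix.single_apply]
    by_cases hab : a = b
    · subst hab
      rw [Finset.sum_eq_single a] <;> simp +contextual
    · rw [Matrix.diagonal_apply_ne _ hab, Finset.sum_eq_zero]
      intro i _
      by_cases h1 : i = a <;> by_cases h2 : i = b <;> simp_all
  rw [h]
  exact sum_pos _ _ fun i _ => compr_pos _ unit_pos

theorem matUnit_isHermitian (n : ℕ) : (matUnit S n).IsHermitian :=
  isHermitian_of_pos (matUnit_pos n)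

theorem matUnit_map {f : S →ₗ[ℂ] T} (hf : f unit = unit) (n : ℕ) :
    (matUnit S n).map f = matUnit T n := by
  simp [matUnit, Matrix.diagonal_map, hf]

theorem IsPos.star_eq {v : S} (h : IsPos v) : star v = v :=
  (isHermitian_of_pos h).apply 0 0

theorem exists_isPos_sub {x : S} (hx : star x = x) :
    ∃ r : ℝ, 0 < r ∧ IsPos ((r : ℂ) • (unit : S) - x) := by
  obtain ⟨r, hr, h⟩ := order_unit (S := S) (X := Matrix.of fun _ _ : Fin 1 => x)
    (by ext i j; simpa using hx)
  refine ⟨r, hr, ?_⟩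
  unfold IsPos
  convert h using 1
  ext i j
  fin_cases i; fin_cases j
  simp

theorem unit_isPos : IsPos (unit : S) := unit_pos

theorem IsPos.smul {v : S} (h : IsPos v) {r : ℝ} (hr : 0 ≤ r) : IsPos ((r : ℂ) • v) := by
  have := smul_pos hr h
  unfold IsPos
  convert this using 1
  ext i j
  rfl

theorem IsPos.add {v w : S} (h : IsPos v) (h' : IsPos w) : IsPos (v + w) := by
  have := add_pos h h'
  unfold IsPos
  convert this using 1
  ext i j
  rfl

/-- A linear map into a *-vector space that sends positive elements to hermitian elements
preserves the involution. -/
theorem map_star_of_isPos {W : Type*} [AddCommGroup W] [Module ℂ W] [StarAddMonoid W]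
    [StarModule ℂ W] (f : S →ₗ[ℂ] W) (hf : ∀ v, IsPos v → star (f v) = f v) (x : S) :
    f (star x) = star (f x) := by
  have key : ∀ y : S, star y = y → star (f y) = f y := by
    intro y hy
    obtain ⟨r, hr, h⟩ := exists_isPos_sub hy
    have h1 := hf _ h
    have h2 := hf _ (unit_isPos.smul hr.le)
    rw [map_sub, star_sub, h2] at h1
    exact sub_right_injective h1
  have h1 := key (x + star x) (by rw [star_add, star_star, add_comm])
  have h2 := key (Complex.I • (x - star x)) (by
    rw [star_smul, star_sub, star_star]
    simp only [Complex.star_def, Complex.conj_I, neg_smul, smul_sub]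
    abel)
  rw [map_smul, star_smul, Complex.star_def, Complex.conj_I, neg_smul, ← smul_neg] at h2
  have h2' := smul_right_injective W Complex.I_ne_zero h2
  rw [map_add, star_add] at h1
  simp only [map_sub, star_sub] at h2'
  have h3 : (2 : ℂ) • f (star x) = (2 : ℂ) • star (f x) := by
    rw [two_smul, two_smul]
    have e4 : star (f x) + star (f x) = f (star x) + f (star x) := by
      calc _ = (star (f x) + star (f (star x))) + -(star (f (star x)) - star (f x)) +
            (f x - f x) - (star (f x) - star (f x)) - (star (f x) - star (f x)) := by abel
        _ = _ := by
          have e5 : star (f (star x)) - star (f x) = f x - f (star x) := by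
            rw [← h2']; abel
          rw [h1, e5]; abel
    exact e4.symm
  exact smul_right_injective W two_ne_zero h3

theorem IsUCP.isPos {f : S →ₗ[ℂ] T} (hf : IsUCP f) {v : S} (hv : IsPos v) : IsPos (f v) :=
  hf.map_pos hv

theorem IsUCP.map_star {f : S →ₗ[ℂ] T} (hf : IsUCP f) (x : S) : f (star x) = star (f x) :=
  map_star_of_isPos f (fun _ hv => (hf.isPos hv).star_eq) x

theorem IsUCP.id : IsUCP (LinearMap.id : S →ₗ[ℂ] S) where
  map_unit := rfl
  map_pos h := by simpa using h

theorem IsUCP.comp {R : Type*} [AddCommGroup R] [Module ℂ R] [StarAddMonoid R]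
    [StarModule ℂ R] [MOUSpace R] {g : T →ₗ[ℂ] R} {f : S →ₗ[ℂ] T} (hg : IsUCP g)
    (hf : IsUCP f) : IsUCP (g.comp f) where
  map_unit := by simp [hf.map_unit, hg.map_unit]
  map_pos h := by
    have := hg.map_pos (hf.map_pos h)
    simpa [Matrix.map_map] using this

theorem IsState.map_star {f : S →ₗ[ℂ] ℂ} (hf : IsState f) (x : S) : f (star x) = star (f x) :=
  map_star_of_isPos f (fun _ hv => (IsSelfAdjoint.of_nonneg (hf.map_pos hv)).star_eq) x

theorem star_mem_nullSpace {x : S} (hx : x ∈ nullSpace S) : star x ∈ nullSpace S :=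
  fun f hf => by rw [hf.map_star, hx f hf, star_zero]

/-- A matrix of complex numbers `M` with `r + M` and `r - M` positive on every vector, up to
the vector's square norm, vanishes. -/
theorem eq_zero_of_form {n : ℕ} {M : Matrix (Fin n) (Fin n) ℂ}
    (h : ∀ α : Matrix (Fin 1) (Fin n) ℂ, ∀ r : ℝ, 0 < r →
      0 ≤ (r : ℂ) * (compr α (1 : Matrix (Fin n) (Fin n) ℂ) 0 0) + compr α M 0 0 ∧
      0 ≤ (r : ℂ) * (compr α (1 : Matrix (Fin n) (Fin n) ℂ) 0 0) - compr α M 0 0) : M = 0 := by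
  have h0 : ∀ α : Matrix (Fin 1) (Fin n) ℂ, compr α M 0 0 = 0 := by
    intro α
    set c := compr α (1 : Matrix (Fin n) (Fin n) ℂ) 0 0
    set d := compr α M 0 0
    have h1 := h α 1 one_pos
    have him := (Complex.le_def.1 h1.1).2
    have him' := (Complex.le_def.1 h1.2).2
    simp only [Complex.zero_im, Complex.add_im, Complex.sub_im] at him him'
    have hd : d.im = 0 := by linarith
    have hre : ∀ r : ℝ, 0 < r → |d.re| ≤ r * c.re := by
      intro r hr
      have a1 := (Complex.le_def.1 (h α r hr).1).1
      have a2 := (Complex.le_def.1 (h α r hr).2).1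
      simp only [Complex.zero_re, Complex.add_re, Complex.sub_re, Complex.re_ofReal_mul] at a1 a2
      rw [abs_le]
      constructor <;> linarith
    have hlim : |d.re| ≤ 0 := by
      refine ge_of_tendsto (x := nhdsWithin 0 (Set.Ioi (0 : ℝ))) (f := fun r => r * c.re) ?_ ?_
      · have : Filter.Tendsto (fun r : ℝ => r * c.re) (nhds 0) (nhds (0 * c.re)) :=
          (continuous_id.mul continuous_const).tendsto 0
        rw [zero_mul] at this
        exact this.mono_left nhdsWithin_le_nhds
      · filter_upwards [self_mem_nhdsWithin] with r hr using hre r hr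
    have : d.re = 0 := abs_eq_zero.1 (le_antisymm hlim (abs_nonneg _))
    exact Complex.ext this hd
  have hpol : ∀ (u v : Fin n → ℂ), ∑ a, ∑ b, (u a * star (v b)) * M a b = 0 := by
    intro u v
    have hh : ∀ w : Fin n → ℂ, ∑ a, ∑ b, (w a * star (w b)) * M a b = 0 := fun w => by
      simpa [compr] using h0 (Matrix.of fun _ a => w a)
    have e1 := hh (u + v)
    have e2 := hh (u + Complex.I • v)
    have eu := hh u
    have ev := hh v
    simp only [Pi.add_apply, Pi.smul_apply, smul_eq_mul, star_add, star_mul', Complex.star_def,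
      Complex.conj_I, add_mul, mul_add, Finset.sum_add_distrib] at e1 e2 eu ev ⊢
    have f1 : ∑ a, ∑ b, u a * (-Complex.I * (starRingEnd ℂ) (v b)) * M a b =
        -Complex.I * ∑ a, ∑ b, u a * (starRingEnd ℂ) (v b) * M a b := by
      simp only [Finset.mul_sum]
      exact Finset.sum_congr rfl fun _ _ => Finset.sum_congr rfl fun _ _ => by ring
    have f2 : ∑ a, ∑ b, Complex.I * v a * (starRingEnd ℂ) (u b) * M a b =
        Complex.I * ∑ a, ∑ b, v a * (starRingEnd ℂ) (u b) * M a b := by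
      simp only [Finset.mul_sum]
      exact Finset.sum_congr rfl fun _ _ => Finset.sum_congr rfl fun _ _ => by ring
    have f3 : ∑ a, ∑ b, Complex.I * v a * (-Complex.I * (starRingEnd ℂ) (v b)) * M a b =
        ∑ a, ∑ b, v a * (starRingEnd ℂ) (v b) * M a b := by
      refine Finset.sum_congr rfl fun _ _ => Finset.sum_congr rfl fun _ _ => ?_
      linear_combination (-(v _ * (starRingEnd ℂ) (v _) * M _ _)) * Complex.I_mul_I
    rw [f1, f2, f3] at e2
    have hI := Complex.I_mul_I
    linear_combination (1 / 2 : ℂ) * (e1 - eu - ev) + (Complex.I / 2) * (e2 - eu - ev) +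
      (1 / 2 : ℂ) * (∑ a, ∑ b, u a * (starRingEnd ℂ) (v b) * M a b -
        ∑ a, ∑ b, v a * (starRingEnd ℂ) (u b) * M a b) * hI
  ext i j
  have := hpol (Pi.single i 1) (Pi.single j 1)
  simpa [Pi.single_apply] using this

end Basic
end MOUSpace

section Quotient

variable {V : Type*} [AddCommGroup V] [Module ℂ V] [StarAddMonoid V] [StarModule ℂ V]

/-- The involution `(v + N)* = v* + N` on the quotient by a selfadjoint subspace `N`. -/
abbrev quotientStarAddMonoid (N : Submodule ℂ V) (hN : ∀ x ∈ N, star x ∈ N) :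
    StarAddMonoid (V ⧸ N) where
  star := Quotient.map' star fun a b h => by
    rw [Submodule.quotientRel_def] at h ⊢
    rw [← star_sub]
    exact hN _ h
  star_involutive := fun x => by
    induction x using Quotient.inductionOn' with
    | h a => exact congrArg Submodule.Quotient.mk (star_star a)
  star_add := fun x y => by
    induction x using Quotient.inductionOn' with
    | h a =>
      induction y using Quotient.inductionOn' with
      | h b => exact congrArg Submodule.Quotient.mk (star_add a b)

theorem quotientStarModule (N : Submodule ℂ V) (hN : ∀ x ∈ N, star x ∈ N) :
    letI := quotientStarAddMonoid N hN
    StarModule ℂ (V ⧸ N) :=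
  letI := quotientStarAddMonoid N hN
  { star_smul := fun c x => by
      induction x using Quotient.inductionOn' with
      | h a => exact congrArg Submodule.Quotient.mk (star_smul c a) }

/-- Hermitian matrices lift to hermitian matrices along a surjective involutive map. -/
theorem exists_isHermitian_lift {W : Type*} [AddCommGroup W] [Module ℂ W] [StarAddMonoid W]
    [StarModule ℂ W] (f : V →ₗ[ℂ] W) (hf : ∀ x, f (star x) = star (f x)) {n : ℕ}
    (Y : Matrix (Fin n) (Fin n) V) (h : (Y.map f).IsHermitian) :
    ∃ Z : Matrix (Fin n) (Fin n) V, Z.IsHermitian ∧ Z.map f = Y.map f := by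
  refine ⟨(2⁻¹ : ℂ) • (Y + Y.conjTranspose), ?_, ?_⟩
  · ext i j
    simp [add_comm]
  · ext i j
    have h1 : star (f (Y j i)) = f (Y i j) := h.apply i j
    simp only [Matrix.map_apply, Matrix.smul_apply, Matrix.add_apply,
      Matrix.conjTranspose_apply, map_smul, map_add, hf, h1]
    rw [← two_smul ℂ, smul_smul]
    norm_num

end Quotient

namespace MOUSpace

section Arch

variable (V : Type*) [AddCommGroup V] [Module ℂ V] [StarAddMonoid V] [StarModule ℂ V]
  [MOUSpace V]

/-- The underlying space `V / N` of the Archimedeanisation of `V`, where `N` is the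
null space of `V`. -/
def Arch : Type _ := V ⧸ nullSpace V

instance : AddCommGroup (Arch V) := inferInstanceAs (AddCommGroup (V ⧸ nullSpace V))
instance : Module ℂ (Arch V) := inferInstanceAs (Module ℂ (V ⧸ nullSpace V))
instance : StarAddMonoid (Arch V) :=
  quotientStarAddMonoid (nullSpace V) fun _ => star_mem_nullSpace
instance : StarModule ℂ (Arch V) :=
  quotientStarModule (nullSpace V) fun _ => star_mem_nullSpace

/-- The quotient map of `V` onto its Archimedeanisation. -/
def Arch.mk : V →ₗ[ℂ] Arch V := (nullSpace V).mkQ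

variable {V}

theorem Arch.mk_star (x : V) : Arch.mk V (star x) = star (Arch.mk V x) := rfl

theorem Arch.mk_surjective : Function.Surjective (Arch.mk V) :=
  Submodule.mkQ_surjective _

theorem Arch.mk_eq_zero {x : V} : Arch.mk V x = 0 ↔ x ∈ nullSpace V :=
  Submodule.Quotient.mk_eq_zero _

theorem Arch.exists_map_mk {n : ℕ} (X : Matrix (Fin n) (Fin n) (Arch V)) :
    ∃ Y : Matrix (Fin n) (Fin n) V, Y.map (Arch.mk V) = X := by
  choose g hg using fun x => Arch.mk_surjective (V := V) x
  exact ⟨X.map g, by ext i j; simp [hg]⟩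

variable (V) in
/-- The matrix cones of the Archimedeanisation: the hermitian matrices `X` over `V / N` such
that `r e^(n) + X` is, for every `r > 0`, the class of an element of `M_n(V)^+`. -/
def archPos (n : ℕ) : Set (Matrix (Fin n) (Fin n) (Arch V)) :=
  {X | X.IsHermitian ∧ ∀ r : ℝ, 0 < r → ∃ A ∈ pos (S := V) n,
    A.map (Arch.mk V) = (r : ℂ) • (Matrix.diagonal fun _ => Arch.mk V unit) + X}

theorem mk_matUnit (n : ℕ) : (matUnit V n).map (Arch.mk V) =
    Matrix.diagonal fun _ => Arch.mk V unit := by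
  simp [matUnit, Matrix.diagonal_map]

theorem compr_matUnit {m n : ℕ} (α : Matrix (Fin m) (Fin n) ℂ) :
    ∃ r : ℝ, 0 < r ∧ (r : ℂ) • matUnit V m - compr α (matUnit V n) ∈ pos m :=
  order_unit (compr_isHermitian α (matUnit_isHermitian n))

theorem IsState.compr_nonneg {f : V →ₗ[ℂ] ℂ} (hf : IsState f) {n : ℕ}
    {A : Matrix (Fin n) (Fin n) V} (hA : A ∈ pos n) (α : Matrix (Fin 1) (Fin n) ℂ) :
    0 ≤ compr α (A.map f) 0 0 := by
  rw [← compr_map]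
  apply hf.map_pos
  have := compr_pos α hA
  unfold IsPos
  convert this using 1
  ext i j
  fin_cases i; fin_cases j; rfl

theorem IsState.map_matUnit {f : V →ₗ[ℂ] ℂ} (hf : IsState f) (n : ℕ) :
    (matUnit V n).map f = 1 := by
  ext i j
  simp [matUnit, Matrix.diagonal_apply, Matrix.one_apply, apply_ite f, hf.map_unit]

theorem archPos_of_pos {n : ℕ} {A : Matrix (Fin n) (Fin n) V} (hA : A ∈ pos n) :
    A.map (Arch.mk V) ∈ archPos V n := by
  refine ⟨map_isHermitian _ Arch.mk_star (isHermitian_of_pos hA), fun r hr =>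
    ⟨(r : ℂ) • matUnit V n + A, add_pos (smul_pos hr.le (matUnit_pos n)) hA, ?_⟩⟩
  rw [← mk_matUnit]
  ext i j
  simp

/-- The Archimedeanisation of `V` is an operator system. -/
instance : OperatorSystem (Arch V) where
  pos := archPos V
  unit := Arch.mk V unit
  isHermitian_of_pos h := h.1
  add_pos := by
    rintro n X Y ⟨hX, hX'⟩ ⟨hY, hY'⟩
    refine ⟨hX.add hY, fun r hr => ?_⟩
    obtain ⟨A, hA, hA'⟩ := hX' (r / 2) (half_pos hr)
    obtain ⟨B, hB, hB'⟩ := hY' (r / 2) (half_pos hr)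
    refine ⟨A + B, add_pos hA hB, ?_⟩
    rw [Matrix.map_add _ (map_add _), hA', hB', add_add_add_comm, ← add_smul]
    norm_num
  smul_pos := by
    rintro n r X hr ⟨hX, hX'⟩
    refine ⟨smul_isHermitian r hX, fun s hs => ?_⟩
    rcases hr.eq_or_lt with rfl | hr
    · refine ⟨(s : ℂ) • matUnit V n, smul_pos hs.le (matUnit_pos n), ?_⟩
      rw [← mk_matUnit]
      ext i j
      simp
    · obtain ⟨A, hA, hA'⟩ := hX' (s / r) (div_pos hs hr)
      refine ⟨(r : ℂ) • A, smul_pos hr.le hA, ?_⟩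
      rw [Matrix.map_smul _ _ (map_smul (Arch.mk V) (r : ℂ)), hA', smul_add, smul_smul]
      congr 2
      push_cast
      rw [mul_div_cancel₀]
      exact_mod_cast hr.ne'
  proper := by
    rintro n X ⟨hX, h1⟩ ⟨_, h2⟩
    obtain ⟨Y, rfl⟩ := Arch.exists_map_mk X
    ext i j
    simp only [Matrix.map_apply, Matrix.zero_apply]
    rw [Arch.mk_eq_zero]
    intro f hf
    have hker : ∀ x y : V, Arch.mk V x = Arch.mk V y → f x = f y := fun x y hxy => by
      have : x - y ∈ nullSpace V := by
        rw [← Arch.mk_eq_zero, map_sub, hxy, sub_self]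
      exact sub_eq_zero.1 (by rw [← map_sub]; exact this f hf)
    have hM : Y.map f = 0 := by
      refine eq_zero_of_form fun α r hr => ⟨?_, ?_⟩
      · obtain ⟨A, hA, hA'⟩ := h1 r hr
        have e : A.map f = (r : ℂ) • (1 : Matrix (Fin n) (Fin n) ℂ) + Y.map f := by
          rw [← hf.map_matUnit]
          ext a b
          have := congrFun (congrFun hA' a) b
          rw [← mk_matUnit] at this
          simp only [Matrix.map_apply, Matrix.add_apply, Matrix.smul_apply, ← map_smul,
            ← map_add] at this
          simpa using hker _ _ this
        have := hf.compr_nonneg hA α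
        rw [e, compr_add, compr_smul] at this
        simpa using this
      · obtain ⟨A, hA, hA'⟩ := h2 r hr
        have e : A.map f = (r : ℂ) • (1 : Matrix (Fin n) (Fin n) ℂ) + -Y.map f := by
          rw [← hf.map_matUnit]
          ext a b
          have := congrFun (congrFun hA' a) b
          rw [← mk_matUnit] at this
          simp only [Matrix.map_apply, Matrix.add_apply, Matrix.smul_apply, Matrix.neg_apply,
            ← map_smul, ← map_add, ← map_neg] at this
          simpa using hker _ _ this
        have := hf.compr_nonneg hA α
        rw [e, compr_add, compr_smul, compr_neg] at this
        simpa [sub_eq_add_neg] using this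
    exact congrFun (congrFun hM i) j
  compr_pos := by
    rintro m n α X ⟨hX, hX'⟩
    refine ⟨compr_isHermitian α hX, fun r hr => ?_⟩
    obtain ⟨s, hs, hs'⟩ := compr_matUnit (V := V) α
    obtain ⟨A, hA, hA'⟩ := hX' (r / s) (div_pos hr hs)
    refine ⟨((r / s : ℝ) : ℂ) • ((s : ℂ) • matUnit V m - compr α (matUnit V n)) + compr α A,
      add_pos (smul_pos (div_pos hr hs).le hs') (compr_pos α hA), ?_⟩
    have hs0 : (s : ℂ) ≠ 0 := by exact_mod_cast hs.ne'
    have e : ((r / s : ℝ) : ℂ) * s = r := by push_cast; field_simp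
    have e2 := compr_map (Arch.mk V) α (matUnit V n)
    have e3 := compr_map (Arch.mk V) α A
    rw [hA', compr_add, compr_smul, ← mk_matUnit, ← e2] at e3
    rw [Matrix.map_add _ (map_add _), e3, ← mk_matUnit]
    ext i j
    simp only [Matrix.add_apply, Matrix.map_apply, Matrix.smul_apply, Matrix.sub_apply,
      map_smul, map_sub, smul_sub, smul_smul, e]
    abel
  unit_pos := by
    have := archPos_of_pos (unit_pos (S := V))
    convert this using 1
    ext i j
    rfl
  order_unit := by
    intro n X hX
    obtain ⟨Y, rfl⟩ := Arch.exists_map_mk X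
    obtain ⟨Z, hZ, hZ'⟩ := exists_isHermitian_lift (Arch.mk V) Arch.mk_star Y hX
    obtain ⟨r, hr, h⟩ := order_unit hZ
    refine ⟨r, hr, ?_⟩
    convert archPos_of_pos h using 1
    rw [← hZ', ← mk_matUnit]
    ext i j
    simp [matUnit, Matrix.diagonal_apply, apply_ite (Arch.mk V)]
  archimedean := by
    intro n X hX h
    refine ⟨hX, fun r hr => ?_⟩
    obtain ⟨A, hA, hA'⟩ := (h (r / 2) (half_pos hr)).2 (r / 2) (half_pos hr)
    refine ⟨A, hA, ?_⟩
    rw [hA', ← add_assoc, ← add_smul]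
    norm_num

theorem Arch.mk_ucp : IsUCP (Arch.mk V) := ⟨rfl, archPos_of_pos⟩

end Arch
end MOUSpace

open MOUSpace

/-- An inductive system `S 0 → S 1 → S 2 → ⋯` with unital completely positive connecting
maps. -/
structure InductiveSystem (S : ℕ → Type*) [∀ k, AddCommGroup (S k)] [∀ k, Module ℂ (S k)]
    [∀ k, StarAddMonoid (S k)] [∀ k, StarModule ℂ (S k)] [∀ k, MOUSpace (S k)] where
  map : ∀ k, S k →ₗ[ℂ] S (k + 1)
  ucp : ∀ k, IsUCP (map k)

namespace InductiveSystem

variable {S : ℕ → Type*} [∀ k, AddCommGroup (S k)] [∀ k, Module ℂ (S k)]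
  [∀ k, StarAddMonoid (S k)] [∀ k, StarModule ℂ (S k)]

section MOU

variable [∀ k, MOUSpace (S k)] (Φ : InductiveSystem S)

/-- The composite `S k → S (k + 1) → ⋯ → S l` of connecting maps. -/
def trans {k l : ℕ} (h : k ≤ l) : S k →ₗ[ℂ] S l :=
  Nat.leRecOn (C := fun j => S k →ₗ[ℂ] S j) h (fun {j} f => (Φ.map j).comp f) LinearMap.id

theorem trans_self (k : ℕ) : Φ.trans (le_refl k) = LinearMap.id :=
  Nat.leRecOn_self (C := fun j => S k →ₗ[ℂ] S j) _

theorem trans_succ {k l : ℕ} (h : k ≤ l) (x : S k) :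
    Φ.trans (h.trans l.le_succ) x = Φ.map l (Φ.trans h x) :=
  LinearMap.congr_fun (Nat.leRecOn_succ (C := fun j => S k →ₗ[ℂ] S j) h LinearMap.id) x

theorem trans_ucp {k l : ℕ} (h : k ≤ l) : IsUCP (Φ.trans h) := by
  induction l, h using Nat.le_induction with
  | base => rw [trans_self]; exact IsUCP.id
  | succ l h ih =>
    have : Φ.trans (h.trans l.le_succ) = (Φ.map l).comp (Φ.trans h) :=
      LinearMap.ext (Φ.trans_succ h)
    rw [this]
    exact (Φ.ucp l).comp ih

theorem trans_trans {k l m : ℕ} (h : k ≤ l) (h' : l ≤ m) (x : S k) :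
    Φ.trans h' (Φ.trans h x) = Φ.trans (h.trans h') x := by
  induction m, h' using Nat.le_induction with
  | base => rw [trans_self]; rfl
  | succ m h' ih => rw [trans_succ _ h', ih, ← trans_succ]

/-- The space of sequences `(x_k)` with `φ_k(x_k) = x_{k+1}` for all large `k`. -/
def coherentSeq : Submodule ℂ (∀ k, S k) where
  carrier := {x | ∃ m, ∀ k, m ≤ k → Φ.map k (x k) = x (k + 1)}
  add_mem' := by
    rintro x y ⟨m, hm⟩ ⟨m', hm'⟩
    refine ⟨max m m', fun k hk => ?_⟩
    rw [Pi.add_apply, Pi.add_apply, map_add, hm k (le_of_max_le_left hk),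
      hm' k (le_of_max_le_right hk)]
  zero_mem' := ⟨0, fun k _ => map_zero _⟩
  smul_mem' := by
    rintro c x ⟨m, hm⟩
    exact ⟨m, fun k hk => by rw [Pi.smul_apply, Pi.smul_apply, map_smul, hm k hk]⟩

instance : StarAddMonoid Φ.coherentSeq where
  star x := ⟨star x.1, by
    obtain ⟨m, hm⟩ := x.2
    exact ⟨m, fun k hk => by
      rw [Pi.star_apply, Pi.star_apply, (Φ.ucp k).map_star, hm k hk]⟩⟩
  star_involutive x := Subtype.ext (star_star x.1)
  star_add x y := Subtype.ext (star_add x.1 y.1)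

instance : StarModule ℂ Φ.coherentSeq where
  star_smul c x := Subtype.ext (star_smul c x.1)

/-- The coherent sequences that are eventually zero. -/
def nullSeq : Submodule ℂ Φ.coherentSeq where
  carrier := {x | ∃ m, ∀ k, m ≤ k → x.1 k = 0}
  add_mem' := by
    rintro x y ⟨m, hm⟩ ⟨m', hm'⟩
    refine ⟨max m m', fun k hk => ?_⟩
    change x.1 k + y.1 k = 0
    rw [hm k (le_of_max_le_left hk), hm' k (le_of_max_le_right hk), add_zero]
  zero_mem' := ⟨0, fun k _ => rfl⟩
  smul_mem' := by
    rintro c x ⟨m, hm⟩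
    refine ⟨m, fun k hk => ?_⟩
    change c • x.1 k = 0
    rw [hm k hk, smul_zero]

theorem star_mem_nullSeq {x : Φ.coherentSeq} (hx : x ∈ Φ.nullSeq) : star x ∈ Φ.nullSeq := by
  obtain ⟨m, hm⟩ := hx
  refine ⟨m, fun k hk => ?_⟩
  change star (x.1 k) = 0
  rw [hm k hk, star_zero]

/-- The underlying space of the inductive limit of matrix ordered *-vector spaces: coherent
sequences modulo eventually zero sequences. -/
def LimMOU : Type _ := Φ.coherentSeq ⧸ Φ.nullSeq

instance : AddCommGroup Φ.LimMOU := inferInstanceAs (AddCommGroup (Φ.coherentSeq ⧸ Φ.nullSeq))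
instance : Module ℂ Φ.LimMOU := inferInstanceAs (Module ℂ (Φ.coherentSeq ⧸ Φ.nullSeq))
instance : StarAddMonoid Φ.LimMOU :=
  quotientStarAddMonoid Φ.nullSeq fun _ => Φ.star_mem_nullSeq
instance : StarModule ℂ Φ.LimMOU :=
  quotientStarModule Φ.nullSeq fun _ => Φ.star_mem_nullSeq

/-- The coherent sequence `(0, …, 0, x, φ_k(x), φ_{k,k+2}(x), …)` with `x` in position `k`. -/
def seqOf (k : ℕ) : S k →ₗ[ℂ] Φ.coherentSeq where
  toFun x := ⟨fun i => if h : k ≤ i then Φ.trans h x else 0, k, fun i hi => by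
    simp only [dif_pos hi, dif_pos (hi.trans i.le_succ), trans_succ _ hi]⟩
  map_add' x y := by
    refine Subtype.ext (funext fun i => ?_)
    change (if h : k ≤ i then Φ.trans h (x + y) else 0) =
      (if h : k ≤ i then Φ.trans h x else 0) + (if h : k ≤ i then Φ.trans h y else 0)
    by_cases h : k ≤ i <;> simp [h]
  map_smul' c x := by
    refine Subtype.ext (funext fun i => ?_)
    change (if h : k ≤ i then Φ.trans h (c • x) else 0) =
      c • (if h : k ≤ i then Φ.trans h x else 0)
    by_cases h : k ≤ i <;> simp [h]

theorem seqOf_apply {k i : ℕ} (h : k ≤ i) (x : S k) : (Φ.seqOf k x).1 i = Φ.trans h x :=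
  dif_pos h

/-- The canonical map of `S k` into the inductive limit of matrix ordered *-vector spaces. -/
def toLimMOU (k : ℕ) : S k →ₗ[ℂ] Φ.LimMOU := Φ.nullSeq.mkQ.comp (Φ.seqOf k)

theorem toLimMOU_eq_zero {k : ℕ} {x : S k} :
    Φ.toLimMOU k x = 0 ↔ ∃ m, ∃ h : k ≤ m, Φ.trans h x = 0 := by
  have h1 : Φ.toLimMOU k x = 0 ↔ Φ.seqOf k x ∈ Φ.nullSeq := Submodule.Quotient.mk_eq_zero _
  rw [h1]
  constructor
  · rintro ⟨m, hm⟩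
    refine ⟨max k m, le_max_left _ _, ?_⟩
    rw [← seqOf_apply]
    exact hm _ (le_max_right _ _)
  · rintro ⟨m, h, hm⟩
    refine ⟨m, fun i hi => ?_⟩
    rw [seqOf_apply _ (h.trans hi), ← Φ.trans_trans h hi, hm, map_zero]

theorem toLimMOU_trans {k l : ℕ} (h : k ≤ l) (x : S k) :
    Φ.toLimMOU l (Φ.trans h x) = Φ.toLimMOU k x := by
  refine (Submodule.Quotient.eq _).2 ⟨l, fun i hi => ?_⟩
  change (Φ.seqOf l _).1 i - (Φ.seqOf k x).1 i = 0
  rw [seqOf_apply _ hi, seqOf_apply _ (h.trans hi), trans_trans, sub_self]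

theorem toLimMOU_star (k : ℕ) (x : S k) :
    Φ.toLimMOU k (star x) = star (Φ.toLimMOU k x) := by
  change Φ.toLimMOU k (star x) = Φ.nullSeq.mkQ (star (Φ.seqOf k x))
  refine (Submodule.Quotient.eq _).2 ⟨k, fun i hi => ?_⟩
  change (Φ.seqOf k (star x)).1 i - star ((Φ.seqOf k x).1 i) = 0
  rw [seqOf_apply _ hi, seqOf_apply _ hi, (Φ.trans_ucp hi).map_star, sub_self]

theorem exists_toLimMOU (x : Φ.LimMOU) : ∃ k, ∃ y : S k, Φ.toLimMOU k y = x := by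
  obtain ⟨s, rfl⟩ := Submodule.mkQ_surjective _ x
  obtain ⟨m, hm⟩ := s.2
  refine ⟨m, s.1 m, (Submodule.Quotient.eq _).2 ⟨m, fun i hi => ?_⟩⟩
  change (Φ.seqOf m (s.1 m)).1 i - s.1 i = 0
  rw [seqOf_apply _ hi, sub_eq_zero]
  induction i, hi using Nat.le_induction with
  | base => rw [trans_self]; rfl
  | succ i hi ih => rw [trans_succ _ hi, ih, hm i hi]

theorem exists_map_toLimMOU {n : ℕ} (X : Matrix (Fin n) (Fin n) Φ.LimMOU) :
    ∃ k, ∃ Y : Matrix (Fin n) (Fin n) (S k), Y.map (Φ.toLimMOU k) = X := by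
  choose k y hy using fun i j => Φ.exists_toLimMOU (X i j)
  have hk : ∀ i j, k i j ≤ ∑ a, ∑ b, k a b := fun i j =>
    (Finset.single_le_sum (f := fun b => k i b) (fun _ _ => Nat.zero_le _)
      (Finset.mem_univ j)).trans
    (Finset.single_le_sum (f := fun a => ∑ b, k a b) (fun _ _ => Nat.zero_le _)
      (Finset.mem_univ i))
  refine ⟨∑ a, ∑ b, k a b, Matrix.of fun i j => Φ.trans (hk i j) (y i j), ?_⟩
  ext i j
  simp only [Matrix.map_apply, Matrix.of_apply, toLimMOU_trans, hy]

theorem exists_trans_eq_zero {n k : ℕ} {Y : Matrix (Fin n) (Fin n) (S k)}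
    (h : Y.map (Φ.toLimMOU k) = 0) : ∃ m, ∃ h : k ≤ m, Y.map (Φ.trans h) = 0 := by
  have h1 : ∀ i j, ∃ m, ∃ h : k ≤ m, Φ.trans h (Y i j) = 0 := fun i j =>
    Φ.toLimMOU_eq_zero.1 (congrFun (congrFun h i) j)
  choose m hm hm' using h1
  have hb : ∀ i j, m i j ≤ k + ∑ a, ∑ b, m a b := fun i j =>
    ((Finset.single_le_sum (f := fun b => m i b) (fun _ _ => Nat.zero_le _)
      (Finset.mem_univ j)).trans
    (Finset.single_le_sum (f := fun a => ∑ b, m a b) (fun _ _ => Nat.zero_le _)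
      (Finset.mem_univ i))).trans (Nat.le_add_left _ _)
  refine ⟨k + ∑ a, ∑ b, m a b, Nat.le_add_right _ _, ?_⟩
  ext i j
  rw [Matrix.map_apply, ← Φ.trans_trans (hm i j) (hb i j), hm', map_zero, Matrix.zero_apply]

theorem map_trans_toLimMOU {n k l : ℕ} (h : k ≤ l) (Y : Matrix (Fin n) (Fin n) (S k)) :
    (Y.map (Φ.trans h)).map (Φ.toLimMOU l) = Y.map (Φ.toLimMOU k) := by
  ext i j
  simp [toLimMOU_trans]

/-- The matrix cones of the limit: the images of the matrix cones of the spaces `S k`. -/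
def limPos (n : ℕ) : Set (Matrix (Fin n) (Fin n) Φ.LimMOU) :=
  {X | ∃ k, ∃ A ∈ pos (S := S k) n, A.map (Φ.toLimMOU k) = X}

theorem limPos_max {n k l : ℕ} (h : k ≤ l) {A : Matrix (Fin n) (Fin n) (S k)}
    (hA : A ∈ pos n) : ∃ B ∈ pos (S := S l) n, B.map (Φ.toLimMOU l) = A.map (Φ.toLimMOU k) :=
  ⟨A.map (Φ.trans h), (Φ.trans_ucp h).map_pos hA, Φ.map_trans_toLimMOU h A⟩

theorem toLimMOU_unit (k : ℕ) : Φ.toLimMOU k unit = Φ.toLimMOU 0 unit := by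
  rw [← Φ.toLimMOU_trans (Nat.zero_le k), (Φ.trans_ucp _).map_unit]

theorem toLimMOU_matUnit (k n : ℕ) : (matUnit (S k) n).map (Φ.toLimMOU k) =
    Matrix.diagonal fun _ => Φ.toLimMOU 0 unit := by
  simp [matUnit, Matrix.diagonal_map, toLimMOU_unit]

/-- The inductive limit of matrix ordered *-vector spaces with matrix order unit. -/
instance : MOUSpace Φ.LimMOU where
  pos := Φ.limPos
  unit := Φ.toLimMOU 0 unit
  isHermitian_of_pos := by
    rintro n X ⟨k, A, hA, rfl⟩
    exact map_isHermitian _ (Φ.toLimMOU_star k) (isHermitian_of_pos hA)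
  add_pos := by
    rintro n X Y ⟨k, A, hA, rfl⟩ ⟨l, B, hB, rfl⟩
    obtain ⟨A', hA', e⟩ := Φ.limPos_max (le_max_left k l) hA
    obtain ⟨B', hB', e'⟩ := Φ.limPos_max (le_max_right k l) hB
    exact ⟨max k l, A' + B', add_pos hA' hB', by rw [Matrix.map_add _ (map_add _), e, e']⟩
  smul_pos := by
    rintro n r X hr ⟨k, A, hA, rfl⟩
    exact ⟨k, (r : ℂ) • A, smul_pos hr hA, Matrix.map_smul _ _ (map_smul (Φ.toLimMOU k) _) A⟩
  proper := by
    rintro n X ⟨k, A, hA, rfl⟩ ⟨l, B, hB, h⟩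
    obtain ⟨A', hA', e⟩ := Φ.limPos_max (le_max_left k l) hA
    obtain ⟨B', hB', e'⟩ := Φ.limPos_max (le_max_right k l) hB
    rw [← e, ← e'] at h
    have h0 : (A' + B').map (Φ.toLimMOU (max k l)) = 0 := by
      rw [Matrix.map_add _ (map_add _), h, add_neg_cancel]
    obtain ⟨m, hm, hm'⟩ := Φ.exists_trans_eq_zero h0
    rw [Matrix.map_add _ (map_add _)] at hm'
    have hA'' := (Φ.trans_ucp hm).map_pos hA'
    have hB'' := (Φ.trans_ucp hm).map_pos hB'
    rw [← neg_eq_of_add_eq_zero_right hm'] at hB''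
    rw [← e, ← Φ.map_trans_toLimMOU hm, proper hA'' hB'']
    ext i j
    simp
  compr_pos := by
    rintro m n α X ⟨k, A, hA, rfl⟩
    exact ⟨k, compr α A, compr_pos α hA, compr_map _ _ _⟩
  unit_pos := ⟨0, _, unit_pos, rfl⟩
  order_unit := by
    intro n X hX
    obtain ⟨k, Y, rfl⟩ := Φ.exists_map_toLimMOU X
    obtain ⟨Z, hZ, hZ'⟩ := exists_isHermitian_lift (Φ.toLimMOU k) (Φ.toLimMOU_star k) Y hX
    obtain ⟨r, hr, h⟩ := order_unit hZ
    refine ⟨r, hr, k, _, h, ?_⟩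
    rw [← hZ', ← Φ.toLimMOU_matUnit k]
    ext i j
    simp [matUnit, Matrix.diagonal_apply, apply_ite (Φ.toLimMOU k)]

theorem toLimMOU_ucp (k : ℕ) : IsUCP (Φ.toLimMOU k) :=
  ⟨Φ.toLimMOU_unit k, fun {_ X} hX => ⟨k, X, hX, rfl⟩⟩

end MOU

section OS

variable [∀ k, OperatorSystem (S k)] (Φ : InductiveSystem S)

/-- The inductive limit of an inductive system of operator systems: the Archimedeanisation of
its limit in the category of matrix ordered *-vector spaces with matrix order unit. -/
abbrev LimOS : Type _ := Arch Φ.LimMOU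

/-- The canonical map of `S k` into the inductive limit of operator systems. -/
def toLimOS (k : ℕ) : S k →ₗ[ℂ] Φ.LimOS := (Arch.mk Φ.LimMOU).comp (Φ.toLimMOU k)

theorem toLimOS_ucp (k : ℕ) : IsUCP (Φ.toLimOS k) := Arch.mk_ucp.comp (Φ.toLimMOU_ucp k)

end OS

end InductiveSystem

namespace OperatorSystem

section Separation

variable {S : Type*} [AddCommGroup S] [Module ℂ S] [StarAddMonoid S] [StarModule ℂ S]
variable [OperatorSystem S]

theorem isPos_of_forall {s : S} (hs : star s = s)
    (h : ∀ r : ℝ, 0 < r → IsPos ((r : ℂ) • (unit : S) + s)) : IsPos s := by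
  refine archimedean (by ext i j; simpa using hs) fun r hr => ?_
  have := h r hr
  unfold IsPos at this
  convert this using 1
  ext i j
  fin_cases i; fin_cases j
  simp

theorem isPos_antisymm {s : S} (h : IsPos s) (h' : IsPos (-s)) : s = 0 := by
  have := proper (X := Matrix.of fun _ _ : Fin 1 => s) h (by
    unfold IsPos at h'
    convert h' using 1
    ext i j
    rfl)
  exact congrFun (congrFun this 0) 0

/-- The positive elements, as a cone in the real space of hermitian elements, enlarged by the
ray of `w`. -/
def coneWith (w : selfAdjoint S) : PointedCone ℝ (selfAdjoint S) where
  carrier := {x | ∃ t : ℝ, 0 ≤ t ∧ IsPos ((x : S) - (t : ℂ) • (w : S))}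
  add_mem' := by
    rintro x y ⟨t, ht, h⟩ ⟨t', ht', h'⟩
    refine ⟨t + t', by positivity, ?_⟩
    convert h.add h' using 1
    push_cast
    rw [add_smul]
    abel
  zero_mem' := ⟨0, le_rfl, by
    have := zero_pos (S := S) 1
    unfold IsPos
    convert this using 1
    ext i j
    simp⟩
  smul_mem' := by
    rintro c x ⟨t, ht, h⟩
    refine ⟨c * t, mul_nonneg c.2 ht, ?_⟩
    convert h.smul c.2 using 1
    rw [smul_sub, smul_smul]
    push_cast
    rfl

theorem exists_state_ne {s : S} (hs : star s = s) (h : ¬ IsPos s) :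
    ∃ f : S →ₗ[ℂ] ℂ, IsState f ∧ f s ≠ 0 := by
  have hex : ∃ r : ℝ, 0 < r ∧ ¬ IsPos ((r : ℂ) • (unit : S) + s) := by
    by_contra hcon
    push Not at hcon
    exact h (isPos_of_forall hs hcon)
  obtain ⟨r, hr, hneg⟩ := hex
  have hun : star (unit : S) = unit := unit_isPos.star_eq
  let e : selfAdjoint S := ⟨unit, hun⟩
  let s' : selfAdjoint S := ⟨s, hs⟩
  let w : selfAdjoint S := -(r • e + s')
  have hw : (w : S) = -((r : ℂ) • (unit : S) + s) := rfl
  have hunit : (unit : S) ≠ 0 := by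
    intro h0
    obtain ⟨q, -, hq⟩ := exists_isPos_sub (S := S) (x := -((r : ℂ) • (unit : S) + s)) (by
      rw [star_neg, star_add, star_smul, hun, hs]; simp)
    apply hneg
    convert hq using 1
    simp [h0]
  have he : e ≠ 0 := fun h0 => hunit (congrArg Subtype.val h0)
  have hone : ∀ a : ℝ, IsPos ((a : ℂ) • (unit : S)) → 0 ≤ a := by
    intro a ha
    by_contra hlt
    push Not at hlt
    apply hunit
    have h1 : IsPos (-(unit : S)) := by
      have := ha.smul (r := (-a)⁻¹) (by rw [inv_nonneg]; linarith)
      convert this using 1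
      rw [smul_smul, ← Complex.ofReal_mul, inv_neg, neg_mul, inv_mul_cancel₀ hlt.ne]
      simp
    exact isPos_antisymm unit_isPos h1
  obtain ⟨g, hg, hg'⟩ := riesz_extension (coneWith w)
    (LinearPMap.mkSpanSingleton (K := ℝ) e (1 : ℝ) he) (by
      rintro ⟨x, hx⟩ ⟨t, ht, hpos⟩
      obtain ⟨a, rfl⟩ := Submodule.mem_span_singleton.1 hx
      have : (LinearPMap.mkSpanSingleton (K := ℝ) e (1 : ℝ) he) ⟨a • e, hx⟩ = a := by
        have := LinearPMap.mkSpanSingleton'_apply (R := ℝ) (S := ℝ) (σ := RingHom.id ℝ) e (1 : ℝ)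
          (by simp [he]) a hx
        simpa using this
      rw [this]
      by_contra hlt
      push Not at hlt
      have e1 : (((a • e : selfAdjoint S) : S) - (t : ℂ) • (w : S)) =
          (a : ℂ) • (unit : S) + (t : ℂ) • ((r : ℂ) • (unit : S) + s) := by
        rw [hw, smul_neg, sub_neg_eq_add]
        rfl
      change IsPos (((a • e : selfAdjoint S) : S) - (t : ℂ) • (w : S)) at hpos
      rw [e1] at hpos
      rcases ht.eq_or_lt with rfl | ht
      · have := hone a (by simpa using hpos)
        linarith
      · apply hneg
        have h2 := (hpos.add (unit_isPos.smul (r := -a) (by linarith))).smul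
          (inv_nonneg.2 ht.le)
        convert h2 using 1
        have ht0 : (t : ℂ) ≠ 0 := by exact_mod_cast ht.ne'
        have : (a : ℂ) • (unit : S) + (t : ℂ) • ((r : ℂ) • (unit : S) + s) +
            ((-a : ℝ) : ℂ) • (unit : S) = (t : ℂ) • ((r : ℂ) • (unit : S) + s) := by
          push_cast
          rw [neg_smul]
          abel
        rw [this, smul_smul]
        push_cast
        rw [inv_mul_cancel₀ ht0, one_smul])
    (by
      intro y
      obtain ⟨q, hq, hq'⟩ := exists_isPos_sub (S := S) (x := -(y : S)) (by
        rw [star_neg]; exact congrArg Neg.neg y.2)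
      refine ⟨⟨q • e, Submodule.mem_span_singleton.2 ⟨q, rfl⟩⟩, 0, le_rfl, ?_⟩
      convert hq' using 1
      simp only [Complex.ofReal_zero, zero_smul, sub_zero, sub_neg_eq_add]
      rfl)
  have hge : g e = 1 := by
    have := hg ⟨e, Submodule.mem_span_singleton_self e⟩
    rw [this]
    have h2 := LinearPMap.mkSpanSingleton_apply ℝ ℝ (σ := RingHom.id ℝ) he (1 : ℝ)
    exact h2
  have hgw : 0 ≤ g w := hg' w ⟨1, zero_le_one, by
    have := zero_pos (S := S) 1
    unfold IsPos
    convert this using 1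
    ext i j
    simp⟩
  have hgs : g s' ≤ -r := by
    have : g w = -(r * 1 + g s') := by rw [map_neg, map_add, map_smul, hge]; rfl
    linarith
  have hgpos : ∀ x : selfAdjoint S, IsPos (x : S) → 0 ≤ g x := fun x hx =>
    hg' x ⟨0, le_rfl, by simpa using hx⟩
  let f : S →ₗ[ℂ] ℂ :=
    { toFun := fun x => (g (realPart x) : ℂ) + Complex.I * (g (imaginaryPart x) : ℂ)
      map_add' := fun x y => by
        simp only [map_add]
        push_cast
        ring
      map_smul' := fun c x => by
        simp only [realPart_smul, imaginaryPart_smul, map_sub, map_add, map_smul, smul_eq_mul,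
          RingHom.id_apply]
        apply Complex.ext <;> simp }
  have hf : ∀ x : selfAdjoint S, f (x : S) = (g x : ℂ) := fun x => by
    change (g (realPart (x : S)) : ℂ) + Complex.I * (g (imaginaryPart (x : S)) : ℂ) = _
    rw [selfAdjoint.realPart_coe, selfAdjoint.imaginaryPart_coe]
    simp
  refine ⟨f, ⟨?_, ?_⟩, ?_⟩
  · have := hf e
    rw [hge] at this
    simpa using this
  · intro v hv
    have := hf ⟨v, hv.star_eq⟩
    rw [show f v = _ from this]
    exact_mod_cast hgpos ⟨v, hv.star_eq⟩ hv
  · have := hf s'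
    rw [show f s = _ from this]
    intro h0
    have : g s' = 0 := by exact_mod_cast h0
    linarith

/-- The states of an operator system separate its points. -/
theorem eq_zero_of_states {s : S} (h : ∀ f : S →ₗ[ℂ] ℂ, IsState f → f s = 0) : s = 0 := by
  have key : ∀ x : S, star x = x → (∀ f : S →ₗ[ℂ] ℂ, IsState f → f x = 0) → x = 0 := by
    intro x hx hfx
    refine isPos_antisymm ?_ ?_
    · by_contra hn
      obtain ⟨f, hf, hne⟩ := exists_state_ne hx hn
      exact hne (hfx f hf)
    · by_contra hn
      obtain ⟨f, hf, hne⟩ := exists_state_ne (by rw [star_neg, hx]) hn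
      exact hne (by rw [map_neg, hfx f hf, neg_zero])
  have hst : ∀ f : S →ₗ[ℂ] ℂ, IsState f → f (star s) = 0 := fun f hf => by
    rw [hf.map_star, h f hf, star_zero]
  rw [← realPart_add_I_smul_imaginaryPart s,
    key _ (realPart s).2 fun f hf => ?_, key _ (imaginaryPart s).2 fun f hf => ?_]
  · simp
  · rw [imaginaryPart_apply_coe, map_smul, ← Complex.coe_smul, map_smul, map_sub, h f hf,
      hst f hf]
    simp
  · rw [realPart_apply_coe, ← Complex.coe_smul, map_smul, map_add, h f hf, hst f hf]
    simp

end Separation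

end OperatorSystem

section Tensor

variable (S : Type*) [AddCommGroup S] [Module ℂ S] (T : Type*) [AddCommGroup T] [Module ℂ T]

/-- The algebraic tensor product of `S` and `T`, with involution `(s ⊗ t)* = s* ⊗ t*`. -/
def AlgTensor : Type _ := S ⊗[ℂ] T

instance : AddCommGroup (AlgTensor S T) := inferInstanceAs (AddCommGroup (S ⊗[ℂ] T))
instance : Module ℂ (AlgTensor S T) := inferInstanceAs (Module ℂ (S ⊗[ℂ] T))

variable [StarAddMonoid S] [StarModule ℂ S] [StarAddMonoid T] [StarModule ℂ T]

instance : StarAddMonoid (AlgTensor S T) := inferInstanceAs (StarAddMonoid (S ⊗[ℂ] T))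
instance : StarModule ℂ (AlgTensor S T) := inferInstanceAs (StarModule ℂ (S ⊗[ℂ] T))

end Tensor

section Tensor

namespace AlgTensor

section Basic

variable {S : Type*} [AddCommGroup S] [Module ℂ S] {T : Type*} [AddCommGroup T] [Module ℂ T]

variable (S T) in
/-- The elementary tensors, as a bilinear map. -/
def tmul : S →ₗ[ℂ] T →ₗ[ℂ] AlgTensor S T := TensorProduct.mk ℂ S T

theorem induction_on {p : AlgTensor S T → Prop} (x : AlgTensor S T) (h0 : p 0)
    (ht : ∀ s t, p (tmul S T s t)) (ha : ∀ x y, p x → p y → p (x + y)) : p x :=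
  TensorProduct.induction_on (motive := p) x h0 ht ha

/-- The matrix `C ⊗ D` with entries `C i j ⊗ D k l`. -/
def kron {m n : Type*} (C : Matrix m m S) (D : Matrix n n T) :
    Matrix (m × n) (m × n) (AlgTensor S T) :=
  Matrix.kroneckerMap (fun s t => tmul S T s t) C D

theorem kron_add_left {m n : Type*} (C C' : Matrix m m S) (D : Matrix n n T) :
    kron (C + C') D = kron C D + kron C' D := by
  ext i j
  simp [kron]

theorem kron_add_right {m n : Type*} (C : Matrix m m S) (D D' : Matrix n n T) :
    kron C (D + D') = kron C D + kron C D' := by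
  ext i j
  simp [kron]

theorem kron_smul_left {m n : Type*} (c : ℂ) (C : Matrix m m S) (D : Matrix n n T) :
    kron (c • C) D = c • kron C D := by
  ext i j
  simp [kron]

theorem kron_compr {m n m' n' : Type*} [Fintype m] [Fintype n] (V : Matrix m' m ℂ)
    (W : Matrix n' n ℂ) (C : Matrix m m S) (D : Matrix n n T) :
    kron (compr V C) (compr W D) =
      compr (Matrix.kroneckerMap (· * ·) V W) (kron C D) := by
  ext ⟨i, i'⟩ ⟨j, j'⟩
  have h1 : tmul S T (compr V C i j) (compr W D i' j') =
      ∑ a', ∑ b', ∑ a, ∑ b, ((W i' a' * star (W j' b')) * (V i a * star (V j b))) •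
        tmul S T (C a b) (D a' b') := by
    simp only [compr, Matrix.of_apply, map_sum, map_smul, LinearMap.sum_apply,
      LinearMap.smul_apply, Finset.smul_sum, smul_smul]
  change tmul S T (compr V C i j) (compr W D i' j') = _
  rw [h1]
  simp only [compr, kron, Matrix.of_apply, Matrix.kroneckerMap_apply, Fintype.sum_prod_type]
  refine Eq.trans ?_ Finset.sum_comm
  refine Finset.sum_congr rfl fun a' _ => Eq.trans Finset.sum_comm ?_
  refine Finset.sum_congr rfl fun a _ => Eq.trans Finset.sum_comm ?_
  refine Finset.sum_congr rfl fun b _ => Finset.sum_congr rfl fun b' _ => ?_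
  rw [star_mul']
  congr 1
  ring

/-- The product of two functionals. -/
def prodFunctional (f : S →ₗ[ℂ] ℂ) (g : T →ₗ[ℂ] ℂ) : AlgTensor S T →ₗ[ℂ] ℂ :=
  LinearMap.mul' ℂ ℂ ∘ₗ TensorProduct.map f g

theorem prodFunctional_tmul (f : S →ₗ[ℂ] ℂ) (g : T →ₗ[ℂ] ℂ) (s : S) (t : T) :
    prodFunctional f g (tmul S T s t) = f s * g t := rfl

end Basic

variable {S : Type*} [AddCommGroup S] [Module ℂ S] [StarAddMonoid S] [StarModule ℂ S]
variable {T : Type*} [AddCommGroup T] [Module ℂ T] [StarAddMonoid T] [StarModule ℂ T]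

theorem star_tmul (s : S) (t : T) : star (tmul S T s t) = tmul S T (star s) (star t) := rfl

theorem kron_isHermitian {m n : Type*} {C : Matrix m m S} {D : Matrix n n T}
    (hC : C.IsHermitian) (hD : D.IsHermitian) : (kron C D).IsHermitian := by
  ext i j
  simp [kron, star_tmul, hC.apply, hD.apply]

section Cones

variable [MOUSpace S] [MOUSpace T]

variable (S T) in
/-- The cones `P_n^max(S, T)` of all `α (C ⊗ D) α*` with `C` and `D` positive matrices over
`S` and `T` and `α` a scalar matrix. -/
def maxPos (n : ℕ) : Set (Matrix (Fin n) (Fin n) (AlgTensor S T)) :=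
  {X | ∃ (k m : ℕ) (C : Matrix (Fin k) (Fin k) S) (D : Matrix (Fin m) (Fin m) T)
    (α : Matrix (Fin n) (Fin k × Fin m) ℂ), C ∈ pos k ∧ D ∈ pos m ∧ X = compr α (kron C D)}

theorem maxPos_compr {m n : ℕ} (α : Matrix (Fin m) (Fin n) ℂ)
    {X : Matrix (Fin n) (Fin n) (AlgTensor S T)} (hX : X ∈ maxPos S T n) :
    compr α X ∈ maxPos S T m := by
  obtain ⟨k, l, C, D, β, hC, hD, rfl⟩ := hX
  exact ⟨k, l, C, D, α * β, hC, hD, compr_compr _ _ _⟩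

theorem maxPos_smul {n : ℕ} {r : ℝ} (hr : 0 ≤ r)
    {X : Matrix (Fin n) (Fin n) (AlgTensor S T)} (hX : X ∈ maxPos S T n) :
    (r : ℂ) • X ∈ maxPos S T n := by
  obtain ⟨k, l, C, D, β, hC, hD, rfl⟩ := hX
  exact ⟨k, l, (r : ℂ) • C, D, β, smul_pos hr hC, hD, by rw [kron_smul_left, compr_smul]⟩

theorem maxPos_isHermitian {n : ℕ} {X : Matrix (Fin n) (Fin n) (AlgTensor S T)}
    (hX : X ∈ maxPos S T n) : X.IsHermitian := by
  obtain ⟨k, l, C, D, β, hC, hD, rfl⟩ := hX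
  exact compr_isHermitian _ (kron_isHermitian (isHermitian_of_pos hC) (isHermitian_of_pos hD))

/-- The inclusion of the first `k` coordinates. -/
def inclL (k l : ℕ) : Matrix (Fin (k + l)) (Fin k) ℂ :=
  Matrix.of fun a p => if a = Fin.castAdd l p then 1 else 0

/-- The inclusion of the last `l` coordinates. -/
def inclR (k l : ℕ) : Matrix (Fin (k + l)) (Fin l) ℂ :=
  Matrix.of fun a p => if a = Fin.natAdd k p then 1 else 0

theorem inclL_inclL (k l : ℕ) : (inclL k l).conjTranspose * inclL k l = 1 := by
  ext i j
  simp only [inclL, Matrix.mul_apply, Matrix.conjTranspose_apply, Matrix.of_apply, apply_ite star,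
    star_one, star_zero, ite_mul, one_mul, zero_mul, Finset.sum_ite_eq', Finset.mem_univ,
    if_true, Matrix.one_apply]
  simp

theorem inclR_inclR (k l : ℕ) : (inclR k l).conjTranspose * inclR k l = 1 := by
  ext i j
  simp only [inclR, Matrix.mul_apply, Matrix.conjTranspose_apply, Matrix.of_apply, apply_ite star,
    star_one, star_zero, ite_mul, one_mul, zero_mul, Finset.sum_ite_eq', Finset.mem_univ,
    if_true, Matrix.one_apply]
  simp

theorem inclL_inclR (k l : ℕ) : (inclL k l).conjTranspose * inclR k l = 0 := by
  ext i j
  have h : (Fin.castAdd l i : Fin (k + l)) ≠ Fin.natAdd k j := by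
    intro h
    have := congrArg Fin.val h
    simp only [Fin.val_castAdd, Fin.val_natAdd] at this
    omega
  simp only [inclL, inclR, Matrix.mul_apply, Matrix.conjTranspose_apply, Matrix.of_apply,
    apply_ite star, star_one, star_zero, ite_mul, one_mul, zero_mul, Finset.sum_ite_eq',
    Finset.mem_univ, if_true, Matrix.zero_apply]
  rw [if_neg h]

theorem inclR_inclL (k l : ℕ) : (inclR k l).conjTranspose * inclL k l = 0 := by
  ext i j
  have h : (Fin.castAdd l j : Fin (k + l)) ≠ Fin.natAdd k i := by
    intro h
    have := congrArg Fin.val h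
    simp only [Fin.val_castAdd, Fin.val_natAdd] at this
    omega
  simp only [inclL, inclR, Matrix.mul_apply, Matrix.conjTranspose_apply, Matrix.of_apply,
    apply_ite star, star_one, star_zero, ite_mul, one_mul, zero_mul, Finset.sum_ite_eq',
    Finset.mem_univ, if_true, Matrix.zero_apply]
  rw [if_neg h.symm]

theorem maxPos_add {n : ℕ} {X Y : Matrix (Fin n) (Fin n) (AlgTensor S T)}
    (hX : X ∈ maxPos S T n) (hY : Y ∈ maxPos S T n) : X + Y ∈ maxPos S T n := by
  obtain ⟨k, m, C, D, α, hC, hD, rfl⟩ := hX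
  obtain ⟨k', m', C', D', α', hC', hD', rfl⟩ := hY
  refine ⟨k + k', m + m', compr (inclL k k') C + compr (inclR k k') C',
    compr (inclL m m') D + compr (inclR m m') D',
    α * (Matrix.kroneckerMap (· * ·) (inclL k k') (inclL m m')).conjTranspose +
      α' * (Matrix.kroneckerMap (· * ·) (inclR k k') (inclR m m')).conjTranspose,
    add_pos (compr_pos _ hC) (compr_pos _ hC'), add_pos (compr_pos _ hD) (compr_pos _ hD'), ?_⟩
  have h0 : ∀ {p q : Type} [Fintype p] [Fintype q] (X : Matrix (p × q) (p × q) (AlgTensor S T)),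
      compr (0 : Matrix (Fin n) (p × q) ℂ) X = 0 := by
    intros
    ext i j
    simp [compr]
  simp only [kron_add_left, kron_add_right, kron_compr, compr_add, compr_compr, Matrix.add_mul,
    Matrix.mul_assoc, Matrix.conjTranspose_kronecker, ← Matrix.mul_kronecker_mul,
    inclL_inclL, inclR_inclR, inclL_inclR, inclR_inclL, Matrix.zero_kronecker,
    Matrix.kronecker_zero, Matrix.mul_zero, Matrix.one_kronecker_one, Matrix.mul_one, h0,
    add_zero, zero_add]

theorem maxPos_zero (n : ℕ) : (0 : Matrix (Fin n) (Fin n) (AlgTensor S T)) ∈ maxPos S T n :=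
  ⟨0, 0, 0, 0, 0, zero_pos 0, zero_pos 0, by ext i j; simp [compr]⟩

theorem maxPos_sum {ι : Type*} (s : Finset ι) {n : ℕ}
    (f : ι → Matrix (Fin n) (Fin n) (AlgTensor S T))
    (h : ∀ i ∈ s, f i ∈ maxPos S T n) : ∑ i ∈ s, f i ∈ maxPos S T n := by
  classical
  induction s using Finset.induction_on with
  | empty => simpa using maxPos_zero n
  | insert a s ha ih =>
    rw [Finset.sum_insert ha]
    exact maxPos_add (h _ (Finset.mem_insert_self _ _))
      (ih fun i hi => h i (Finset.mem_insert_of_mem hi))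

/-- `C ⊗ t` is in the cone for positive `C` over `S` and positive `t` in `T`. -/
theorem maxPos_map_tmul {n : ℕ} {C : Matrix (Fin n) (Fin n) S} (hC : C ∈ pos n) {t : T}
    (ht : IsPos t) : (C.map fun s => tmul S T s t) ∈ maxPos S T n := by
  refine ⟨n, 1, C, _, Matrix.of fun i p => if i = p.1 then 1 else 0, hC, ht, ?_⟩
  ext i j
  simp [compr, kron, Fintype.sum_prod_type]

theorem exists_maxPos_hermitian {n : ℕ} {B : Matrix (Fin n) (Fin n) S} (hB : B.IsHermitian)
    {t : T} (ht : star t = t) : ∃ r : ℝ, 0 < r ∧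
      (r : ℂ) • (Matrix.diagonal fun _ => tmul S T unit unit) +
        (B.map fun s => tmul S T s t) ∈ maxPos S T n := by
  obtain ⟨a, ha, h1⟩ := order_unit hB
  obtain ⟨a', ha', h2⟩ := order_unit (hB.neg)
  obtain ⟨b, hb, h3⟩ := exists_isPos_sub ht
  obtain ⟨b', hb', h4⟩ := exists_isPos_sub (x := -t) (by rw [star_neg, ht])
  have hbb := (unit_isPos (S := T)).smul hb.le
  have g1 : ((max a a' : ℝ) : ℂ) • matUnit S n - B ∈ pos n := by
    have := add_pos h1 (smul_pos (sub_nonneg.2 (le_max_left a a')) (matUnit_pos n))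
    convert this using 1
    push_cast
    rw [sub_smul]
    simp only [matUnit]
    abel
  have g2 : ((max a a' : ℝ) : ℂ) • matUnit S n + B ∈ pos n := by
    have := add_pos h2 (smul_pos (sub_nonneg.2 (le_max_right a a')) (matUnit_pos n))
    convert this using 1
    push_cast
    rw [sub_smul]
    simp only [matUnit]
    abel
  have g3 : IsPos (((max b b' : ℝ) : ℂ) • (unit : T) - t) := by
    have := h3.add (unit_isPos.smul (sub_nonneg.2 (le_max_left b b')))
    convert this using 1
    push_cast
    rw [sub_smul]
    abel
  have g4 : IsPos (((max b b' : ℝ) : ℂ) • (unit : T) + t) := by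
    have := h4.add (unit_isPos.smul (sub_nonneg.2 (le_max_right b b')))
    convert this using 1
    push_cast
    rw [sub_smul]
    abel
  have hA : 0 < max a a' := ha.trans_le (le_max_left _ _)
  have hB' : 0 < max b b' := hb.trans_le (le_max_left _ _)
  generalize max a a' = A at *
  generalize max b b' = B' at *
  refine ⟨A * B', mul_pos hA hB', ?_⟩
  have := maxPos_smul (r := 1 / 2) (by norm_num)
    (maxPos_add (maxPos_map_tmul g2 g4) (maxPos_map_tmul g1 g3))
  convert this using 1
  ext i j
  have hd : (Matrix.diagonal fun _ : Fin n => tmul S T unit unit) i j =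
      tmul S T (matUnit S n i j) unit := by
    simp only [matUnit, Matrix.diagonal_apply]
    split_ifs <;> simp
  simp only [Matrix.add_apply, Matrix.smul_apply, Matrix.map_apply, Matrix.sub_apply, hd,
    map_add, map_sub, map_smul, LinearMap.add_apply, LinearMap.sub_apply, LinearMap.smul_apply]
  push_cast
  module

theorem exists_maxPos_real {n : ℕ} (X : Matrix (Fin n) (Fin n) (AlgTensor S T)) :
    ∃ r : ℝ, 0 < r ∧ (r : ℂ) • (Matrix.diagonal fun _ => tmul S T unit unit) +
      (X + X.conjTranspose) ∈ maxPos S T n := by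
  have hadd : ∀ X Y : Matrix (Fin n) (Fin n) (AlgTensor S T),
      (∃ r : ℝ, 0 < r ∧ (r : ℂ) • (Matrix.diagonal fun _ => tmul S T unit unit) +
        (X + X.conjTranspose) ∈ maxPos S T n) →
      (∃ r : ℝ, 0 < r ∧ (r : ℂ) • (Matrix.diagonal fun _ => tmul S T unit unit) +
        (Y + Y.conjTranspose) ∈ maxPos S T n) →
      ∃ r : ℝ, 0 < r ∧ (r : ℂ) • (Matrix.diagonal fun _ => tmul S T unit unit) +
        ((X + Y) + (X + Y).conjTranspose) ∈ maxPos S T n := by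
    rintro X Y ⟨r, hr, h⟩ ⟨r', hr', h'⟩
    refine ⟨r + r', _root_.add_pos hr hr', ?_⟩
    convert maxPos_add h h' using 1
    rw [Matrix.conjTranspose_add]
    push_cast
    rw [add_smul]
    abel
  have hzero : ∃ r : ℝ, 0 < r ∧ (r : ℂ) • (Matrix.diagonal fun _ => tmul S T unit unit) +
      ((0 : Matrix (Fin n) (Fin n) (AlgTensor S T)) +
        (0 : Matrix (Fin n) (Fin n) (AlgTensor S T)).conjTranspose) ∈ maxPos S T n := by
    obtain ⟨r, hr, h⟩ := exists_maxPos_hermitian (S := S) (T := T) (n := n)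
      (Matrix.isHermitian_zero) (star_zero T)
    refine ⟨r, hr, ?_⟩
    convert h using 2
    ext i j
    simp
  have hherm : ∀ (B : Matrix (Fin n) (Fin n) S) (t : T), star t = t →
      ∃ r : ℝ, 0 < r ∧ (r : ℂ) • (Matrix.diagonal fun _ => tmul S T unit unit) +
        ((B.map fun s => tmul S T s t) + (B.map fun s => tmul S T s t).conjTranspose) ∈
          maxPos S T n := by
    intro B t ht
    obtain ⟨r, hr, h⟩ := exists_maxPos_hermitian (B := B + B.conjTranspose) (by
      ext i j; simp [add_comm]) ht
    refine ⟨r, hr, ?_⟩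
    convert h using 2
    ext i j
    simp [star_tmul, ht]
  have htmul : ∀ (i j : Fin n) (s : S) (t : T),
      ∃ r : ℝ, 0 < r ∧ (r : ℂ) • (Matrix.diagonal fun _ => tmul S T unit unit) +
        (Matrix.single i j (tmul S T s t) + (Matrix.single i j (tmul S T s t)).conjTranspose) ∈
          maxPos S T n := by
    intro i j s t
    have e : Matrix.single i j (tmul S T s t) =
        ((Matrix.single i j s).map fun s => tmul S T s (realPart t : T)) +
        ((Matrix.single i j (Complex.I • s)).map fun s => tmul S T s (imaginaryPart t : T)) := by
      ext a b
      have : tmul S T s t = tmul S T s (realPart t : T) +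
          tmul S T (Complex.I • s) (imaginaryPart t : T) := by
        conv_lhs => rw [← realPart_add_I_smul_imaginaryPart t]
        simp
      simp only [Matrix.single_apply, Matrix.add_apply, Matrix.map_apply]
      split_ifs <;> simp [this]
    rw [e]
    exact hadd _ _ (hherm _ _ (realPart t).2) (hherm _ _ (imaginaryPart t).2)
  have hsingle : ∀ (i j : Fin n) (x : AlgTensor S T),
      ∃ r : ℝ, 0 < r ∧ (r : ℂ) • (Matrix.diagonal fun _ => tmul S T unit unit) +
        (Matrix.single i j x + (Matrix.single i j x).conjTranspose) ∈ maxPos S T n := by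
    intro i j x
    induction x using induction_on with
    | h0 => rw [Matrix.single_zero]; exact hzero
    | ht s t => exact htmul i j s t
    | ha x y hx hy => rw [Matrix.single_add]; exact hadd _ _ hx hy
  have hsum : ∀ (u : Finset (Fin n × Fin n)),
      ∃ r : ℝ, 0 < r ∧ (r : ℂ) • (Matrix.diagonal fun _ => tmul S T unit unit) +
        ((∑ p ∈ u, Matrix.single p.1 p.2 (X p.1 p.2)) +
          (∑ p ∈ u, Matrix.single p.1 p.2 (X p.1 p.2)).conjTranspose) ∈ maxPos S T n := by
    intro u
    induction u using Finset.induction_on with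
    | empty => rw [Finset.sum_empty]; exact hzero
    | insert p u hp ih => rw [Finset.sum_insert hp]; exact hadd _ _ (hsingle _ _ _) ih
  have := hsum Finset.univ
  have e : ∑ p : Fin n × Fin n, Matrix.single p.1 p.2 (X p.1 p.2) = X := by
    conv_rhs => rw [Matrix.matrix_eq_sum_single X]
    exact Fintype.sum_prod_type _
  rwa [e] at this

end Cones

section States

theorem posSemidef_of_compr {n : ℕ} {M : Matrix (Fin n) (Fin n) ℂ} (hM : M.IsHermitian)
    (h : ∀ α : Matrix (Fin 1) (Fin n) ℂ, 0 ≤ compr α M 0 0) : M.PosSemidef := by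
  refine Matrix.PosSemidef.of_dotProduct_mulVec_nonneg hM fun x => ?_
  have := h (Matrix.of fun _ a => star (x a))
  convert this using 1
  simp only [dotProduct, Matrix.mulVec, compr, Matrix.of_apply, Finset.mul_sum, Pi.star_apply,
    star_star, smul_eq_mul]
  exact Finset.sum_congr rfl fun a _ => Finset.sum_congr rfl fun b _ => by ring

theorem compr_eq_mul {m n : Type*} [Fintype n] (α : Matrix m n ℂ) (M : Matrix n n ℂ) :
    compr α M = α * M * α.conjTranspose := by
  ext i j
  simp only [compr, Matrix.of_apply, Matrix.mul_apply, Matrix.conjTranspose_apply,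
    Finset.sum_mul, smul_eq_mul]
  rw [Finset.sum_comm]
  exact Finset.sum_congr rfl fun a _ => Finset.sum_congr rfl fun b _ => by ring

theorem map_posSemidef [MOUSpace S] {f : S →ₗ[ℂ] ℂ} (hf : IsState f) {n : ℕ}
    {C : Matrix (Fin n) (Fin n) S} (hC : C ∈ pos n) : (C.map f).PosSemidef :=
  posSemidef_of_compr (map_isHermitian f hf.map_star (isHermitian_of_pos hC))
    (hf.compr_nonneg hC)

theorem prodFunctional_posSemidef [MOUSpace S] [MOUSpace T] {f : S →ₗ[ℂ] ℂ} {g : T →ₗ[ℂ] ℂ}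
    (hf : IsState f) (hg : IsState g) {n : ℕ} {X : Matrix (Fin n) (Fin n) (AlgTensor S T)}
    (hX : X ∈ maxPos S T n) : (X.map (prodFunctional f g)).PosSemidef := by
  obtain ⟨k, m, C, D, α, hC, hD, rfl⟩ := hX
  have e : (kron C D).map (prodFunctional f g) =
      Matrix.kroneckerMap (· * ·) (C.map f) (D.map g) := by
    ext i j
    simp [kron, prodFunctional_tmul]
  rw [compr_map, e, compr_eq_mul]
  exact ((map_posSemidef hf hC).kronecker (map_posSemidef hg hD)).mul_mul_conjTranspose_same α

theorem eq_zero_of_prodFunctional [OperatorSystem S] [OperatorSystem T] {z : AlgTensor S T}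
    (h : ∀ (f : S →ₗ[ℂ] ℂ) (g : T →ₗ[ℂ] ℂ), IsState f → IsState g →
      prodFunctional f g z = 0) : z = 0 := by
  let R : (T →ₗ[ℂ] ℂ) → S ⊗[ℂ] T →ₗ[ℂ] S := fun g =>
    (TensorProduct.rid ℂ S).toLinearMap ∘ₗ LinearMap.lTensor S g
  let L : (S →ₗ[ℂ] ℂ) → S ⊗[ℂ] T →ₗ[ℂ] T := fun f =>
    (TensorProduct.lid ℂ T).toLinearMap ∘ₗ LinearMap.rTensor T f
  let P : (S →ₗ[ℂ] ℂ) → (T →ₗ[ℂ] ℂ) → S ⊗[ℂ] T →ₗ[ℂ] ℂ := fun f g => prodFunctional f g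
  let w : S ⊗[ℂ] T := z
  have hR : ∀ f g, P f g = f ∘ₗ R g := fun f g => TensorProduct.ext' fun s t => by
    change f s * g t = f (g t • s)
    rw [map_smul, smul_eq_mul, mul_comm]
  have hL : ∀ f g, g ∘ₗ L f = f ∘ₗ R g := fun f g => TensorProduct.ext' fun s t => by
    change g (f s • t) = f (g t • s)
    rw [map_smul, map_smul, smul_eq_mul, smul_eq_mul, mul_comm]
  have h1 : ∀ g : T →ₗ[ℂ] ℂ, IsState g → R g w = 0 := fun g hg =>
    OperatorSystem.eq_zero_of_states fun f hf => by
      have := LinearMap.congr_fun (hR f g) w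
      exact this.symm.trans (h f g hf hg)
  have h2 : ∀ l : S →ₗ[ℂ] ℂ, L l w = 0 := fun l =>
    OperatorSystem.eq_zero_of_states fun g hg => by
      have := LinearMap.congr_fun (hL l g) w
      refine this.trans ?_
      rw [LinearMap.comp_apply, h1 g hg, map_zero]
  classical
  let b := Module.Basis.ofVectorSpace ℂ S
  have h3 : TensorProduct.equivFinsuppOfBasisLeft (N := T) b w = 0 := by
    ext i
    rw [TensorProduct.equivFinsuppOfBasisLeft_apply]
    exact h2 (b.coord i)
  exact (LinearEquiv.map_eq_zero_iff _).1 h3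

end States

variable [OperatorSystem S] [OperatorSystem T]

/-- The algebraic tensor product of two operator systems with the cones `P_n^max` and the
unit `1 ⊗ 1` is a matrix ordered *-vector space with matrix order unit. -/
instance : MOUSpace (AlgTensor S T) where
  pos := maxPos S T
  unit := tmul S T unit unit
  isHermitian_of_pos := maxPos_isHermitian
  add_pos := maxPos_add
  smul_pos := fun hr hX => maxPos_smul hr hX
  proper := by
    intro n X hX hX'
    ext i j
    refine eq_zero_of_prodFunctional fun f g hf hg => ?_
    have p1 := prodFunctional_posSemidef hf hg hX
    have p2 := prodFunctional_posSemidef hf hg hX'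
    have key : ∀ {M : Matrix (Fin n) (Fin n) ℂ}, M.PosSemidef →
        ∀ α : Matrix (Fin 1) (Fin n) ℂ, 0 ≤ compr α M 0 0 := fun hM α => by
      rw [compr_eq_mul]
      exact (hM.mul_mul_conjTranspose_same α).diag_nonneg
    have e : (-X).map (prodFunctional f g) = -(X.map (prodFunctional f g)) := by
      ext a b
      simp
    have : X.map (prodFunctional f g) = 0 := eq_zero_of_form fun α r hr => by
      have q0 := mul_nonneg (show (0 : ℂ) ≤ (r : ℂ) by exact_mod_cast hr.le)
        (key Matrix.PosSemidef.one α)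
      have q1 := key p1 α
      have q2 := key p2 α
      rw [e, compr_neg] at q2
      exact ⟨add_nonneg q0 q1, by rw [sub_eq_add_neg]; exact add_nonneg q0 q2⟩
    exact congrFun (congrFun this i) j
  compr_pos := fun α _ => maxPos_compr α
  unit_pos := by
    have := maxPos_map_tmul (unit_pos (S := S)) (unit_isPos (S := T))
    convert this using 1
    ext i j
    rfl
  order_unit := by
    intro n X hX
    obtain ⟨r, hr, h⟩ := exists_maxPos_real ((-(2⁻¹ : ℂ)) • X)
    refine ⟨r, hr, ?_⟩
    convert h using 1
    have h2 : X.conjTranspose = X := hX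
    rw [Matrix.conjTranspose_smul, h2, sub_eq_add_neg]
    congr 1
    simp only [star_neg, star_inv₀, star_ofNat]
    module

/-- The null space of the algebraic tensor product is zero, so that the Archimedeanisation
of `AlgTensor S T` has the algebraic tensor product itself as its underlying space. -/
theorem nullSpace_eq_bot : nullSpace (AlgTensor S T) = ⊥ := by
  refine (Submodule.eq_bot_iff _).2 fun z hz => eq_zero_of_prodFunctional fun f g hf hg => ?_
  refine hz _ ⟨?_, fun {v} hv => ?_⟩
  · change prodFunctional f g (tmul S T unit unit) = 1
    rw [prodFunctional_tmul]
    rw [hf.map_unit, hg.map_unit, one_mul]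
  · have hv' : (Matrix.of fun _ _ : Fin 1 => v) ∈ maxPos S T 1 := hv
    exact (prodFunctional_posSemidef hf hg hv').diag_nonneg (i := 0)

end AlgTensor

end Tensor

section MaxTensor

variable (S : Type*) [AddCommGroup S] [Module ℂ S] [StarAddMonoid S] [StarModule ℂ S]
  [OperatorSystem S]
variable (T : Type*) [AddCommGroup T] [Module ℂ T] [StarAddMonoid T] [StarModule ℂ T]
  [OperatorSystem T]

/-- The maximal operator system tensor product `S ⊗_max T`: the Archimedeanisation of
`(S ⊗ T, {P_n^max}, 1 ⊗ 1)`. -/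
abbrev MaxTensor : Type _ := Arch (AlgTensor S T)

variable {S T}

/-- The elementary tensors in `S ⊗_max T`. -/
def MaxTensor.tmul (s : S) (t : T) : MaxTensor S T :=
  Arch.mk (AlgTensor S T) (AlgTensor.tmul S T s t)

end MaxTensor

namespace AlgTensor

section RMap

variable {S : Type*} [AddCommGroup S] [Module ℂ S] {S' : Type*} [AddCommGroup S'] [Module ℂ S']
  {T : Type*} [AddCommGroup T] [Module ℂ T]

variable (T) in
/-- The map `f ⊗ id` on algebraic tensor products. -/
def rMap (f : S →ₗ[ℂ] S') : AlgTensor S T →ₗ[ℂ] AlgTensor S' T := LinearMap.rTensor T f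

theorem rMap_tmul (f : S →ₗ[ℂ] S') (s : S) (t : T) :
    rMap T f (tmul S T s t) = tmul S' T (f s) t := rfl

end RMap

variable {S : Type*} [AddCommGroup S] [Module ℂ S] [StarAddMonoid S] [StarModule ℂ S]
  [OperatorSystem S]
variable {S' : Type*} [AddCommGroup S'] [Module ℂ S'] [StarAddMonoid S'] [StarModule ℂ S']
  [OperatorSystem S']
variable {T : Type*} [AddCommGroup T] [Module ℂ T] [StarAddMonoid T] [StarModule ℂ T]
  [OperatorSystem T]

theorem rMap_ucp {f : S →ₗ[ℂ] S'} (hf : IsUCP f) : IsUCP (rMap T f) where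
  map_unit := by
    change rMap T f (tmul S T unit unit) = tmul S' T unit unit
    rw [rMap_tmul, hf.map_unit]
  map_pos := by
    rintro n X ⟨k, m, C, D, α, hC, hD, rfl⟩
    refine ⟨k, m, C.map f, D, α, hf.map_pos hC, hD, ?_⟩
    rw [compr_map]
    congr 1

end AlgTensor

namespace MOUSpace

variable {V : Type*} [AddCommGroup V] [Module ℂ V] [StarAddMonoid V] [StarModule ℂ V]
  [MOUSpace V]
variable {W : Type*} [AddCommGroup W] [Module ℂ W] [StarAddMonoid W] [StarModule ℂ W]
  [MOUSpace W]

theorem IsUCP.comp_isState {f : V →ₗ[ℂ] W} (hf : IsUCP f) {g : W →ₗ[ℂ] ℂ} (hg : IsState g) :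
    IsState (g.comp f) :=
  ⟨by rw [LinearMap.comp_apply, hf.map_unit, hg.map_unit], fun hv => hg.map_pos (hf.isPos hv)⟩

/-- The map induced on Archimedeanisations by a unital completely positive map. -/
def Arch.map (f : V →ₗ[ℂ] W) (hf : IsUCP f) : Arch V →ₗ[ℂ] Arch W :=
  (nullSpace V).mapQ (nullSpace W) f fun _ hx _ hg => hx _ (hf.comp_isState hg)

theorem Arch.map_mk (f : V →ₗ[ℂ] W) (hf : IsUCP f) (x : V) :
    Arch.map f hf (Arch.mk V x) = Arch.mk W (f x) := rfl

theorem Arch.map_ucp {f : V →ₗ[ℂ] W} (hf : IsUCP f) : IsUCP (Arch.map f hf) where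
  map_unit := congrArg (Arch.mk W) hf.map_unit
  map_pos := by
    rintro n X ⟨hX, hX'⟩
    refine ⟨map_isHermitian _ (fun x => ?_) hX, fun r hr => ?_⟩
    · obtain ⟨x, rfl⟩ := Arch.mk_surjective x
      rw [← Arch.mk_star, map_mk, map_mk, hf.map_star, Arch.mk_star]
    · obtain ⟨A, hA, hA'⟩ := hX' r hr
      refine ⟨A.map f, hf.map_pos hA, ?_⟩
      have h1 : (A.map f).map (Arch.mk W) = (A.map (Arch.mk V)).map (Arch.map f hf) := by
        ext i j
        rfl
      rw [h1, hA', Matrix.map_add _ (map_add _), Matrix.map_smul _ _ (map_smul _ (r : ℂ)),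
        Matrix.diagonal_map (map_zero _)]
      simp only [map_mk, hf.map_unit]

end MOUSpace

namespace InductiveSystem

variable {S : ℕ → Type*} [∀ k, AddCommGroup (S k)] [∀ k, Module ℂ (S k)]
  [∀ k, StarAddMonoid (S k)] [∀ k, StarModule ℂ (S k)] [∀ k, OperatorSystem (S k)]

/-- The inductive system `S 0 ⊗_max T → S 1 ⊗_max T → ⋯` with connecting maps `φ_k ⊗ id`. -/
def maxTensor (Φ : InductiveSystem S) (T : Type*) [AddCommGroup T] [Module ℂ T]
    [StarAddMonoid T] [StarModule ℂ T] [OperatorSystem T] :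
    InductiveSystem (fun k => MaxTensor (S k) T) where
  map k := Arch.map (AlgTensor.rMap T (Φ.map k)) (AlgTensor.rMap_ucp (Φ.ucp k))
  ucp k := Arch.map_ucp (AlgTensor.rMap_ucp (Φ.ucp k))

end InductiveSystem

end

noncomputable section

open scoped TensorProduct ComplexOrder
open MOUSpace

/-! Both directions come from universal properties, and the two resulting maps are inverse to each
other because they match the generators ψ_{k,∞}(s ⊗ t) and φ_{k,∞}(s) ⊗ t.

From left to right, the maps φ_{k,∞} ⊗ id are unital completely positive and compatible with the
connecting maps, so they induce a map on the algebraic limit (`limLift`). It passes to the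
Archimedeanisation because its target is an operator system: states separate the points there, so
the null space is killed, and the Archimedean property takes care of the enlarged cones
(`Arch.lift_ucp`).

From right to left, the bilinear map (φ_{k,∞}(s), t) ↦ ψ_{k,∞}(s ⊗ t) is first defined on the
algebraic limit. Two points need an argument. First, it must vanish when its first argument lies in
the null space N (`limBilin_eq_zero`): for positive t and a state g of the target, slicing by t and
g gives a positive functional on the algebraic limit, and such a functional kills N once it is
nonzero at the unit. Secondly, the induced map on (lim S_k) ⊙ T must be completely positive
(`algTensorLimHom_ucp`). In a generator α(C ⊗ D)α* the matrix C is positive only in the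
Archimedeanised sense: r e + C comes from a positive matrix at a finite stage, for every r > 0.
Hence the image of α(C ⊗ D)α* becomes positive after adding r times the fixed element E' that is the
image of α(e ⊗ D)α*. A multiple of the order unit dominates E', so the Archimedean property of the
target removes the perturbation.

Elements and identities are only ever compared at a sufficiently late finite stage, so the
connecting maps need not be injective. -/

namespace MOUSpace

/-! ### Maps out of an Archimedeanisation, and functionals on its null space -/

section ArchLift

variable {V : Type*} [AddCommGroup V] [Module ℂ V] [StarAddMonoid V] [StarModule ℂ V]
  [MOUSpace V]
variable {W : Type*} [AddCommGroup W] [Module ℂ W] [StarAddMonoid W] [StarModule ℂ W]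

/-- A unital completely positive map into an operator system factors through the
Archimedeanisation. -/
def Arch.lift [OperatorSystem W] (f : V →ₗ[ℂ] W) (hf : IsUCP f) : Arch V →ₗ[ℂ] W :=
  (nullSpace V).liftQ f fun _ hx =>
    -- A state of `W` composed with `f` is a state of `V`, so it kills `x`; the states of `W`
    -- separate points.
    OperatorSystem.eq_zero_of_states fun _ hg => hx _ (hf.comp_isState hg)

theorem Arch.lift_mk [OperatorSystem W] (f : V →ₗ[ℂ] W) (hf : IsUCP f) (x : V) :
    Arch.lift f hf (Arch.mk V x) = f x := rfl

/-- A positive matrix over the Archimedeanisation lifts to a positive one only after adding r e^(n),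
for each r > 0. Its image is thus positive up to r e^(n), and the target, being Archimedean, allows
r → 0. -/
theorem Arch.lift_ucp [OperatorSystem W] {f : V →ₗ[ℂ] W} (hf : IsUCP f) :
    IsUCP (Arch.lift f hf) where
  map_unit := hf.map_unit
  map_pos := by
    rintro n X ⟨hX, hX'⟩
    refine OperatorSystem.archimedean (map_isHermitian _ (fun x => ?_) hX) fun r hr => ?_
    · obtain ⟨x, rfl⟩ := Arch.mk_surjective x
      rw [← Arch.mk_star, lift_mk, lift_mk, hf.map_star]
    · obtain ⟨A, hA, hA'⟩ := hX' r hr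
      have h1 : A.map f = (A.map (Arch.mk V)).map (Arch.lift f hf) := rfl
      have h2 := hf.map_pos hA
      rw [h1, hA', Matrix.map_add _ (map_add _), Matrix.map_smul _ _ (map_smul _ (r : ℂ)),
        Matrix.diagonal_map (map_zero _)] at h2
      simpa only [lift_mk, hf.map_unit] using h2

/-- A positive functional that is nonzero at the unit is a multiple of a state, and hence vanishes
on the null space. -/
theorem eq_zero_of_mem_nullSpace {x : V} (hx : x ∈ nullSpace V) {f : V →ₗ[ℂ] ℂ}
    (hf : ∀ v, IsPos v → 0 ≤ f v) (h1 : f unit ≠ 0) : f x = 0 := by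
  have h : IsState ((f unit)⁻¹ • f) := by
    refine ⟨?_, fun {v} hv => ?_⟩
    · rw [LinearMap.smul_apply, smul_eq_mul, inv_mul_cancel₀ h1]
    · rw [LinearMap.smul_apply, smul_eq_mul]
      exact mul_nonneg (inv_nonneg.2 (hf _ unit_isPos)) (hf _ hv)
  have := hx _ h
  rw [LinearMap.smul_apply, smul_eq_mul] at this
  exact (mul_eq_zero.1 this).resolve_left (inv_ne_zero h1)

/-- A linear map vanishes if it vanishes on positive elements. -/
theorem linearMap_eq_zero_of_isPos {W : Type*} [AddCommGroup W] [Module ℂ W] {f : V →ₗ[ℂ] W}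
    (h : ∀ v, IsPos v → f v = 0) : f = 0 := by
  -- The order unit writes a hermitian y as r·1 − (r·1 − y), a difference of positive elements.
  have hsa : ∀ y : V, star y = y → f y = 0 := fun y hy => by
    obtain ⟨r, hr, hr'⟩ := exists_isPos_sub hy
    have h1 := h _ hr'
    rw [map_sub, h _ (unit_isPos.smul hr.le), zero_sub, neg_eq_zero] at h1
    exact h1
  ext x
  rw [← realPart_add_I_smul_imaginaryPart x, map_add, map_smul, hsa _ (realPart x).2,
    hsa _ (imaginaryPart x).2]
  simp

end ArchLift

end MOUSpace

namespace InductiveSystem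

/-! ### The universal property of the algebraic inductive limit -/

section LimLift

variable {S : ℕ → Type*} [∀ k, AddCommGroup (S k)] [∀ k, Module ℂ (S k)]
  [∀ k, StarAddMonoid (S k)] [∀ k, StarModule ℂ (S k)] [∀ k, MOUSpace (S k)]
  (Φ : InductiveSystem S)
variable {W : Type*} [AddCommGroup W] [Module ℂ W] (f : ∀ k, S k →ₗ[ℂ] W)

theorem compatible_trans (hf : ∀ k x, f (k + 1) (Φ.map k x) = f k x)
    {k l : ℕ} (h : k ≤ l) (x : S k) : f l (Φ.trans h x) = f k x := by
  induction l, h using Nat.le_induction with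
  | base => rw [trans_self]; rfl
  | succ l h ih => rw [trans_succ _ h, hf, ih]

/-- Two representatives of one element of the limit have the same image at some later stage `m`, and
a compatible family can be evaluated there. Consequently `limLift` does not depend on the chosen
representative. -/
theorem compatible_eq (hf : ∀ k x, f (k + 1) (Φ.map k x) = f k x)
    {k l : ℕ} {x : S k} {y : S l}
    (h : Φ.toLimMOU k x = Φ.toLimMOU l y) : f k x = f l y := by
  have h1 : Φ.toLimMOU (max k l)
      (Φ.trans (le_max_left k l) x - Φ.trans (le_max_right k l) y) = 0 := by
    rw [map_sub, toLimMOU_trans, toLimMOU_trans, h, sub_self]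
  obtain ⟨m, hm, hm'⟩ := Φ.toLimMOU_eq_zero.1 h1
  have h2 := Φ.compatible_trans f hf hm
    (Φ.trans (le_max_left k l) x - Φ.trans (le_max_right k l) y)
  rw [hm', map_zero, map_sub, Φ.compatible_trans f hf, Φ.compatible_trans f hf] at h2
  exact (sub_eq_zero.1 h2.symm)

theorem exists_toLimMOU_pair (x y : Φ.LimMOU) :
    ∃ k, ∃ a b : S k, Φ.toLimMOU k a = x ∧ Φ.toLimMOU k b = y := by
  obtain ⟨k, a, rfl⟩ := Φ.exists_toLimMOU x
  obtain ⟨l, b, rfl⟩ := Φ.exists_toLimMOU y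
  exact ⟨max k l, _, _, Φ.toLimMOU_trans (le_max_left k l) a,
    Φ.toLimMOU_trans (le_max_right k l) b⟩

/-- The linear map on the limit induced by a compatible sequence of linear maps. -/
def limLift (hf : ∀ k x, f (k + 1) (Φ.map k x) = f k x) : Φ.LimMOU →ₗ[ℂ] W where
  toFun x := f _ (Φ.exists_toLimMOU x).choose_spec.choose
  map_add' x y := by
    obtain ⟨k, a, b, rfl, rfl⟩ := Φ.exists_toLimMOU_pair x y
    -- The representative chosen for the image of `c` may sit at another stage than `k`, but the
    -- value there is still `f k c`.
    have h : ∀ (c : S k), f _ (Φ.exists_toLimMOU (Φ.toLimMOU k c)).choose_spec.choose = f k c :=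
      fun c => Φ.compatible_eq f hf (Φ.exists_toLimMOU (Φ.toLimMOU k c)).choose_spec.choose_spec
    rw [h, h, ← map_add, ← map_add, h]
  map_smul' c x := by
    obtain ⟨k, a, rfl⟩ := Φ.exists_toLimMOU x
    have h : ∀ (c : S k), f _ (Φ.exists_toLimMOU (Φ.toLimMOU k c)).choose_spec.choose = f k c :=
      fun c => Φ.compatible_eq f hf (Φ.exists_toLimMOU (Φ.toLimMOU k c)).choose_spec.choose_spec
    rw [h, ← map_smul, h, map_smul]
    rfl

theorem limLift_toLimMOU (hf : ∀ k x, f (k + 1) (Φ.map k x) = f k x)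
    (k : ℕ) (x : S k) : Φ.limLift f hf (Φ.toLimMOU k x) = f k x :=
  Φ.compatible_eq f hf (Φ.exists_toLimMOU (Φ.toLimMOU k x)).choose_spec.choose_spec

/-- The cones of the algebraic limit are exactly the images of the cones of the stages, so the
target need not be Archimedean here. -/
theorem limLift_ucp (hf : ∀ k x, f (k + 1) (Φ.map k x) = f k x)
    [StarAddMonoid W] [StarModule ℂ W] [MOUSpace W] (h : ∀ k, IsUCP (f k)) :
    IsUCP (Φ.limLift f hf) where
  map_unit := (Φ.limLift_toLimMOU f hf 0 unit).trans (h 0).map_unit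
  map_pos := by
    rintro n _ ⟨k, A, hA, rfl⟩
    convert (h k).map_pos hA using 1
    ext i j
    exact Φ.limLift_toLimMOU f hf k _

end LimLift

/-! ### The canonical map from the limit of the tensor products -/

section MaxTensor

variable {S : ℕ → Type*} [∀ k, AddCommGroup (S k)] [∀ k, Module ℂ (S k)]
  [∀ k, StarAddMonoid (S k)] [∀ k, StarModule ℂ (S k)] [∀ k, OperatorSystem (S k)]
  (Φ : InductiveSystem S)
  (T : Type*) [AddCommGroup T] [Module ℂ T] [StarAddMonoid T] [StarModule ℂ T]
  [OperatorSystem T]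

theorem toLimOS_map (k : ℕ) (x : S k) : Φ.toLimOS (k + 1) (Φ.map k x) = Φ.toLimOS k x := by
  have h := Φ.toLimMOU_trans k.le_succ x
  have h' := Φ.trans_succ (le_refl k) x
  rw [trans_self] at h'
  rw [h'] at h
  exact congrArg (Arch.mk Φ.LimMOU) h

/-- The maps `φ_{k,∞} ⊗ id` on maximal tensor products. -/
def tensorToLim (k : ℕ) : MaxTensor (S k) T →ₗ[ℂ] MaxTensor Φ.LimOS T :=
  Arch.map (AlgTensor.rMap T (Φ.toLimOS k)) (AlgTensor.rMap_ucp (Φ.toLimOS_ucp k))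

theorem tensorToLim_map (k : ℕ) (x : MaxTensor (S k) T) :
    Φ.tensorToLim T (k + 1) ((Φ.maxTensor T).map k x) = Φ.tensorToLim T k x := by
  obtain ⟨x, rfl⟩ := Arch.mk_surjective x
  induction x using AlgTensor.induction_on with
  | h0 => simp only [map_zero]
  | ht s t =>
    change MaxTensor.tmul (Φ.toLimOS (k + 1) (Φ.map k s)) t = MaxTensor.tmul (Φ.toLimOS k s) t
    rw [toLimOS_map]
  | ha x y hx hy => simp only [map_add, hx, hy]

/-- The canonical map `lim (S k ⊗_max T) → (lim S k) ⊗_max T`. -/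
def limTensorHom : (Φ.maxTensor T).LimOS →ₗ[ℂ] MaxTensor Φ.LimOS T :=
  Arch.lift ((Φ.maxTensor T).limLift (Φ.tensorToLim T) (Φ.tensorToLim_map T))
    (limLift_ucp _ _ _ fun k => Arch.map_ucp (AlgTensor.rMap_ucp (Φ.toLimOS_ucp k)))

theorem limTensorHom_ucp : IsUCP (Φ.limTensorHom T) := Arch.lift_ucp _

theorem limTensorHom_toLimOS (k : ℕ) (s : S k) (t : T) :
    Φ.limTensorHom T ((Φ.maxTensor T).toLimOS k (MaxTensor.tmul s t)) =
      MaxTensor.tmul (Φ.toLimOS k s) t :=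
  (Φ.maxTensor T).limLift_toLimMOU (Φ.tensorToLim T) (Φ.tensorToLim_map T) k _

/-! ### The bilinear map on the algebraic limit and its vanishing on the null space -/

/-- The map `S k ⊗ T → lim (S k ⊗_max T)`. -/
def algToLim (k : ℕ) : AlgTensor (S k) T →ₗ[ℂ] (Φ.maxTensor T).LimOS :=
  ((Φ.maxTensor T).toLimOS k).comp (Arch.mk _)

/-- Gives positivity in the limit directly from the generators α(B ⊗ D)α* at stage `k`, with no
Archimedean perturbation in the tensor product. -/
theorem algToLim_ucp (k : ℕ) : IsUCP (Φ.algToLim T k) :=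
  ((Φ.maxTensor T).toLimOS_ucp k).comp Arch.mk_ucp

/-- Compatibility in curried form: `limLift` is to be applied with values in the space of linear
maps on `T`, where only the linear structure matters. -/
theorem algToLim_map (k : ℕ) (s : S k) :
    ((AlgTensor.tmul (S (k + 1)) T).compr₂ (Φ.algToLim T (k + 1))) (Φ.map k s) =
      ((AlgTensor.tmul (S k) T).compr₂ (Φ.algToLim T k)) s := by
  ext t
  exact (Φ.maxTensor T).toLimOS_map k (MaxTensor.tmul s t)

/-- The bilinear map `(φ_{k,∞}(s), t) ↦ ψ_{k,∞}(s ⊗ t)` on the algebraic limit. -/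
def limBilin : Φ.LimMOU →ₗ[ℂ] T →ₗ[ℂ] (Φ.maxTensor T).LimOS :=
  Φ.limLift (fun k => (AlgTensor.tmul (S k) T).compr₂ (Φ.algToLim T k)) (Φ.algToLim_map T)

theorem limBilin_apply (k : ℕ) (s : S k) (t : T) :
    Φ.limBilin T (Φ.toLimMOU k s) t = Φ.algToLim T k (AlgTensor.tmul (S k) T s t) := by
  rw [limBilin, limLift_toLimMOU]
  rfl

/-- A positive v in the algebraic limit is the image of a positive s in some `S k`, and s ⊗ t then
lies in P_1^max at that stage. -/
theorem limBilin_isPos {v : Φ.LimMOU} (hv : IsPos v) {t : T} (ht : IsPos t) :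
    IsPos (Φ.limBilin T v t) := by
  obtain ⟨k, A, hA, h⟩ := hv
  have hv : Φ.toLimMOU k (A 0 0) = v := congrFun (congrFun h 0) 0
  rw [← hv, limBilin_apply]
  refine (Φ.algToLim_ucp T k).isPos ?_
  change _ ∈ AlgTensor.maxPos (S k) T 1
  convert AlgTensor.maxPos_map_tmul hA ht using 1
  ext i j
  fin_cases i; fin_cases j; rfl

theorem limBilin_unit : Φ.limBilin T unit unit = unit :=
  (Φ.limBilin_apply T 0 unit unit).trans (Φ.algToLim_ucp T 0).map_unit

/-- This is what lets the bilinear map descend from the algebraic limit to its Archimedeanisation.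
Since positive elements span `T` and states separate the points of the target, it suffices to test
against a positive t and a state g. The functional v ↦ g(B(v, t)), with B the bilinear map, is then
positive, hence a multiple of a state unless it vanishes at the unit. -/
theorem limBilin_eq_zero {x : Φ.LimMOU} (hx : x ∈ nullSpace Φ.LimMOU) :
    Φ.limBilin T x = 0 := by
  refine linearMap_eq_zero_of_isPos fun t ht => OperatorSystem.eq_zero_of_states fun g hg => ?_
  have key : ∀ u : T, IsPos u → g (Φ.limBilin T unit u) ≠ 0 → g (Φ.limBilin T x u) = 0 :=
    fun u hu h1 => eq_zero_of_mem_nullSpace (f := g ∘ₗ (Φ.limBilin T).flip u) hx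
      (fun v hv => hg.map_pos (Φ.limBilin_isPos T hv hu)) h1
  have h1 := key unit unit_isPos (by rw [limBilin_unit, hg.map_unit]; exact one_ne_zero)
  -- The value g(B(1, t)) may be 0. Replacing t by t + 1 raises it to g(B(1, t)) + 1 > 0, and the
  -- extra term g(B(x, 1)) vanishes by `h1`.
  have h2 := key (t + unit) (ht.add unit_isPos) (by
    rw [map_add, limBilin_unit, map_add, hg.map_unit]
    have := hg.map_pos (Φ.limBilin_isPos T unit_isPos ht)
    exact (add_pos_of_nonneg_of_pos this one_pos).ne')
  rwa [map_add, map_add, h1, add_zero] at h2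

/-! ### The map out of the tensor product of the limit, and its complete positivity -/

/-- The canonical map `(lim S k) ⊗ T → lim (S k ⊗_max T)`. -/
def algTensorLimHom : AlgTensor Φ.LimOS T →ₗ[ℂ] (Φ.maxTensor T).LimOS :=
  TensorProduct.lift ((nullSpace Φ.LimMOU).liftQ (Φ.limBilin T) fun _ hx =>
    Φ.limBilin_eq_zero T hx)

theorem algTensorLimHom_tmul (k : ℕ) (s : S k) (t : T) :
    Φ.algTensorLimHom T (AlgTensor.tmul _ T (Φ.toLimOS k s) t) =
      Φ.algToLim T k (AlgTensor.tmul (S k) T s t) :=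
  Φ.limBilin_apply T k s t

/-- Moves the computation of an image back to stage `k`, where P^max is available. It is used both
for a positive lift of r e + C and for the unit matrix at stage 0. -/
theorem algTensorLimHom_compr_kron {n p q k : ℕ} (α : Matrix (Fin n) (Fin p × Fin q) ℂ)
    (B : Matrix (Fin p) (Fin p) (S k)) (D : Matrix (Fin q) (Fin q) T) :
    (compr α (AlgTensor.kron (B.map (Φ.toLimOS k)) D)).map (Φ.algTensorLimHom T) =
      (compr α (AlgTensor.kron B D)).map (Φ.algToLim T k) := by
  rw [compr_map, compr_map]
  congr 1
  ext i j
  exact Φ.algTensorLimHom_tmul T k _ _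

/-- The matrix C of a generator α(C ⊗ D)α* need not lift to a positive matrix at any stage; only the
perturbations r e + C do. Tensoring turns the perturbation r e into r α(e ⊗ D)α*, which is no
multiple of the unit but is bounded by one, so the Archimedean property still applies. -/
theorem algTensorLimHom_ucp : IsUCP (Φ.algTensorLimHom T) where
  map_unit := Φ.limBilin_unit T
  map_pos := by
    rintro n _ ⟨p, q, C, D, α, ⟨-, hC⟩, hD, rfl⟩
    -- Stage 0 suffices for the unit, because every canonical map is unital.
    have hE : compr α (AlgTensor.kron (matUnit (S 0) p) D) ∈ pos n :=
      ⟨p, q, _, D, α, matUnit_pos p, hD, rfl⟩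
    have hE' := (Φ.algToLim_ucp T 0).map_pos hE
    -- Here b·1 dominates the image E' of α(e ⊗ D)α*. The bound depends on α and D but not on r.
    obtain ⟨b, hb, hb'⟩ := order_unit (isHermitian_of_pos hE')
    have key : ∀ r : ℝ, 0 < r → (r : ℂ) •
        (compr α (AlgTensor.kron (matUnit (S 0) p) D)).map (Φ.algToLim T 0) +
        (compr α (AlgTensor.kron C D)).map (Φ.algTensorLimHom T) ∈ pos n := by
      intro r hr
      -- The stage `k` and the lift `B` of r e + C depend on r. This is harmless, since the
      -- conclusion of `key` is stated in the limit.
      obtain ⟨_, ⟨k, B, hB, rfl⟩, hA⟩ := hC r hr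
      have h1 : (compr α (AlgTensor.kron B D)).map (Φ.algToLim T k) ∈ pos n :=
        (Φ.algToLim_ucp T k).map_pos ⟨p, q, B, D, α, hB, hD, rfl⟩
      have h2 : B.map (Φ.toLimOS k) =
          (r : ℂ) • (matUnit (S 0) p).map (Φ.toLimOS 0) + C := by
        rw [matUnit_map (Φ.toLimOS_ucp 0).map_unit]
        exact hA
      rw [← algTensorLimHom_compr_kron, h2, AlgTensor.kron_add_left, AlgTensor.kron_smul_left,
        compr_add, compr_smul, Matrix.map_add _ (map_add _),
        Matrix.map_smul _ _ (map_smul _ (r : ℂ)), algTensorLimHom_compr_kron] at h1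
      exact h1
    refine OperatorSystem.archimedean ?_ fun r hr => ?_
    -- The image is hermitian as the difference of the positive matrix of `key` at r = 1 and the
    -- hermitian E'.
    · have h1 := (isHermitian_of_pos (key 1 one_pos)).sub
        (smul_isHermitian 1 (isHermitian_of_pos hE'))
      rwa [add_sub_cancel_left] at h1
    -- With X the image of the generator, (r/b)(b·1 − E') + ((r/b)E' + X) = r·1 + X, and both
    -- summands are positive.
    · have h1 := add_pos (smul_pos (div_pos hr hb).le hb') (key (r / b) (div_pos hr hb))
      have e : ((r / b : ℝ) : ℂ) * b = r := by
        have : (b : ℂ) ≠ 0 := by exact_mod_cast hb.ne'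
        push_cast
        field_simp
      rwa [smul_sub, smul_smul, e, ← add_assoc, sub_add_cancel] at h1

/-- The canonical map `(lim S k) ⊗_max T → lim (S k ⊗_max T)`. -/
def tensorLimHom : MaxTensor Φ.LimOS T →ₗ[ℂ] (Φ.maxTensor T).LimOS :=
  Arch.lift (Φ.algTensorLimHom T) (Φ.algTensorLimHom_ucp T)

theorem tensorLimHom_ucp : IsUCP (Φ.tensorLimHom T) := Arch.lift_ucp _

theorem tensorLimHom_tmul (k : ℕ) (s : S k) (t : T) :
    Φ.tensorLimHom T (MaxTensor.tmul (Φ.toLimOS k s) t) =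
      (Φ.maxTensor T).toLimOS k (MaxTensor.tmul s t) :=
  Φ.algTensorLimHom_tmul T k s t

/-! ### The two maps are mutually inverse -/

/-- Archimedeanisation is only a quotient, with no completion, so every element of the limit comes
from a finite stage. The composites can therefore be compared on elementary tensors, without any
continuity. -/
theorem exists_toLimOS (x : Φ.LimOS) : ∃ k, ∃ s : S k, Φ.toLimOS k s = x := by
  obtain ⟨x, rfl⟩ := Arch.mk_surjective x
  obtain ⟨k, s, rfl⟩ := Φ.exists_toLimMOU x
  exact ⟨k, s, rfl⟩

theorem tensorLimHom_limTensorHom (x : (Φ.maxTensor T).LimOS) :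
    Φ.tensorLimHom T (Φ.limTensorHom T x) = x := by
  obtain ⟨k, x, rfl⟩ := (Φ.maxTensor T).exists_toLimOS x
  obtain ⟨x, rfl⟩ := Arch.mk_surjective x
  induction x using AlgTensor.induction_on with
  | h0 => simp only [map_zero]
  | ht s t =>
    change Φ.tensorLimHom T
      (Φ.limTensorHom T ((Φ.maxTensor T).toLimOS k (MaxTensor.tmul s t))) = _
    rw [limTensorHom_toLimOS, tensorLimHom_tmul]
    rfl
  | ha x y hx hy => simp only [map_add, hx, hy]

theorem limTensorHom_tensorLimHom (x : MaxTensor Φ.LimOS T) :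
    Φ.limTensorHom T (Φ.tensorLimHom T x) = x := by
  obtain ⟨x, rfl⟩ := Arch.mk_surjective x
  induction x using AlgTensor.induction_on with
  | h0 => simp only [map_zero]
  | ht s t =>
    -- The first leg is some φ_{k,∞}(s), which reduces the claim to the tensors on which both maps
    -- are known.
    obtain ⟨k, s, rfl⟩ := Φ.exists_toLimOS s
    change Φ.limTensorHom T (Φ.tensorLimHom T (MaxTensor.tmul (Φ.toLimOS k s) t)) = _
    rw [tensorLimHom_tmul, limTensorHom_toLimOS]
    rfl
  | ha x y hx hy => simp only [map_add, hx, hy]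

end MaxTensor

end InductiveSystem

end

theorem theorem4p29 {S : ℕ → Type*} [∀ k, AddCommGroup (S k)] [∀ k, Module ℂ (S k)]
    [∀ k, StarAddMonoid (S k)] [∀ k, StarModule ℂ (S k)] [∀ k, OperatorSystem (S k)]
    (Φ : InductiveSystem S)
    (T : Type*) [AddCommGroup T] [Module ℂ T] [StarAddMonoid T] [StarModule ℂ T]
    [OperatorSystem T] :
    ∃ β : (Φ.maxTensor T).LimOS ≃ₗ[ℂ] MaxTensor Φ.LimOS T,
      MOUSpace.IsUnitalCompleteOrderIso β ∧
      ∀ (k : ℕ) (s : S k) (t : T),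
        β ((Φ.maxTensor T).toLimOS k (MaxTensor.tmul s t)) =
          MaxTensor.tmul (Φ.toLimOS k s) t :=
  ⟨LinearEquiv.ofLinearMap (Φ.limTensorHom T) (Φ.tensorLimHom T)
      (LinearMap.ext (Φ.limTensorHom_tensorLimHom T))
      (LinearMap.ext (Φ.tensorLimHom_limTensorHom T)),
    ⟨Φ.limTensorHom_ucp T, Φ.tensorLimHom_ucp T⟩, Φ.limTensorHom_toLimOS T⟩
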